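/- Let $p$ be a prime and $n\ge 1$. Equip $\mathbb{Q}_p^n$ with the norm $|x|_p=\max_{j}|x_j|_p$ and with the Haar measure $|\cdot|_h$ (also written $\mathrm{d}x$) for which the unit ball has measure $1$. For $\gamma\in\mathbb{Z}$ and $x\in\mathbb{Q}_p^n$ put $B_\gamma(x)=\{y:|x-y|_p\le p^\gamma\}$. Functions are real-valued and are identified when they agree almost everywhere. Exponents. For measurable $q(\cdot):\mathbb{Q}_p^n\to\mathbb{R}$ and a set $E$, let $q_-(E)$, $q_+(E)$ be the essential infimum and supremum of $q$ over $E$, and $q_\pm=q_\pm(\mathbb{Q}_p^n)$. Let $\mathscr{P}$ be the set of measurable $q(\cdot)$ with $1<q_-\le q(x)\le q_+<\infty$ for all $x$, and let $\mathscr{C}^{\log}$ be the set of $q(\cdot)\in\mathscr{P}$ for which there is a constant $C>0$ with $$\gamma\big(q_-(B_\gamma(x))-q_+(B_\gamma(x))\big)\le C\quad(\gamma\in\mathbb{Z},\ x\in\mathbb{Q}_p^n),\qquad |q(x)-q(y)|\le\frac{C}{\log_p(p+\min\{|x|_p,|y|_p\})}\quad(x,y\in\mathbb{Q}_p^n).$$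 For $q(\cdot)\in\mathscr{P}$, $L^{q(\cdot)}(\mathbb{Q}_p^n)$ is the set of measurable $f$ with $\int(|f(x)|/\eta)^{q(x)}\,\mathrm{d}x<\infty$ for some $\eta>0$, with the norm $\|f\|_{q(\cdot)}=\inf\{\eta>0:\int(|f(x)|/\eta)^{q(x)}\,\mathrm{d}x\le1\}$. Let $0<\beta<1$, $0<\alpha<\alpha+\beta<n$, and let $b$ be locally integrable on $\mathbb{Q}_p^n$. Let $\Lambda_\beta(\mathbb{Q}_p^n)$ be the space of measurable $f$ with $\sup_{x\ne y}|f(x)-f(y)|/|x-y|_p^\beta<\infty$. Let $$\mathcal{M}^p_{\alpha,b}(f)(x)=\sup_{\gamma\in\mathbb{Z}}\frac{1}{|B_\gamma(x)|_h^{1-\alpha/n}}\int_{B_\gamma(x)}|b(x)-b(y)|\,|f(y)|\,\mathrm{d}y,$$ and let $b_{B}=|B|_h^{-1}\int_{B}b(y)\,\mathrm{d}y$ for a ball $B$. Call a pair $r(\cdot),q(\cdot)$ admissible if $r(\cdot),q(\cdot)\in\mathscr{C}^{\log}$, $r(\cdot)\in\mathscr{P}$, $r_+<\frac{n}{\alpha+\beta}$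 and $\frac1{q(x)}=\frac1{r(x)}-\frac{\alpha+\beta}{n}$ for all $x$. Then the following assertions are equivalent. (B.1) $b\in\Lambda_\beta(\mathbb{Q}_p^n)$, that is, $b$ agrees almost everywhere with a function in $\Lambda_\beta(\mathbb{Q}_p^n)$. (B.2) For all admissible pairs $r(\cdot),q(\cdot)$, $\mathcal{M}^p_{\alpha,b}$ is bounded from $L^{r(\cdot)}(\mathbb{Q}_p^n)$ to $L^{q(\cdot)}(\mathbb{Q}_p^n)$, that is, there is a constant $C$ such that, for every $f\in L^{r(\cdot)}(\mathbb{Q}_p^n)$, $\mathcal{M}^p_{\alpha,b}(f)\in L^{q(\cdot)}(\mathbb{Q}_p^n)$ and $\|\mathcal{M}^p_{\alpha,b}(f)\|_{q(\cdot)}\le C\|f\|_{r(\cdot)}$. (B.3) For some admissible pair $r(\cdot),q(\cdot)$, $\mathcal{M}^p_{\alpha,b}$ is bounded from $L^{r(\cdot)}(\mathbb{Q}_p^n)$ to $L^{q(\cdot)}(\mathbb{Q}_p^n)$. (B.4) For some admissible pair $r(\cdot),q(\cdot)$, $$\sup_{\gamma\in\mathbb{Z},\,x\in\mathbb{Q}_p^n}\frac{1}{|B_\gamma(x)|_h^{\beta/n}}\,\frac{\big\|(b-b_{B_\gamma(x)})\chi_{B_\gamma(x)}\big\|_{q(\cdot)}}{\big\|\chi_{B_\gamma(x)}\big\|_{q(\cdot)}}<\infty.\qquad(*)$$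 (B.5) For all admissible pairs $r(\cdot),q(\cdot)$, $(*)$ holds. -/

import Mathlib

open MeasureTheory
open scoped ENNReal NNReal

namespace PadicVarLebesgue

noncomputable instance instMeasurableSpacePadic (p : ℕ) [Fact p.Prime] : MeasurableSpace ℚ_[p] :=
  borel ℚ_[p]

instance instBorelSpacePadic (p : ℕ) [Fact p.Prime] : BorelSpace ℚ_[p] := ⟨rfl⟩

/-- The space `ℚ_p^n`; as a function space it carries the maximum norm
`|x|_p = max_j |x_j|_p`. -/
abbrev Qpn (p : ℕ) [Fact p.Prime] (n : ℕ) : Type := Fin n → ℚ_[p]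

/-- The ball `B_γ(a) = {x : |x - a|_p ≤ p^γ}`. -/
def pball {p : ℕ} [Fact p.Prime] {n : ℕ} (γ : ℤ) (a : Qpn p n) : Set (Qpn p n) :=
  Metric.closedBall a ((p : ℝ) ^ γ)

/-- The unit ball `B_0(0)` as a compact set with non-empty interior. -/
def unitBall (p : ℕ) [Fact p.Prime] (n : ℕ) : TopologicalSpace.PositiveCompacts (Qpn p n) where
  carrier := pball 0 0
  isCompact' := isCompact_closedBall _ _
  interior_nonempty' :=
    ⟨0, interior_mono Metric.ball_subset_closedBall (by
      rw [Metric.isOpen_ball.interior_eq]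
      exact Metric.mem_ball_self (by simp))⟩

/-- The Haar measure on `ℚ_p^n`, normalized so that the unit ball has measure `1`. -/
noncomputable def haar (p : ℕ) [Fact p.Prime] (n : ℕ) : Measure (Qpn p n) :=
  Measure.addHaarMeasure (unitBall p n)

section Spaces

variable {p : ℕ} [Fact p.Prime] {n : ℕ}

/-- The class `𝒫(ℚ_p^n)`: measurable `q` with `1 < q_- ≤ q(x) ≤ q_+ < ∞` for all `x`, where `q_-`
and `q_+` are the essential infimum and supremum. (An essentially unbounded `q` has `essSup q = 0`
in `ℝ`, so it is excluded.) -/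
structure IsExponent (q : Qpn p n → ℝ) : Prop where
  measurable : Measurable q
  one_lt : 1 < essInf q (haar p n)
  essInf_le : ∀ x, essInf q (haar p n) ≤ q x
  le_essSup : ∀ x, q x ≤ essSup q (haar p n)

/-- The class `𝒞^log(ℚ_p^n)` of globally log-Hölder continuous exponents:
`γ (q_-(B_γ(x)) - q_+(B_γ(x))) ≤ C` for all balls, and
`|q(x) - q(y)| ≤ C / log_p(p + min(|x|_p, |y|_p))` for all points. -/
structure IsLogHolder (q : Qpn p n → ℝ) : Prop where
  isExponent : IsExponent q
  loc : ∃ C : ℝ, 0 < C ∧ ∀ (γ : ℤ) (x : Qpn p n),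
    (γ : ℝ) * (essInf q ((haar p n).restrict (pball γ x))
      - essSup q ((haar p n).restrict (pball γ x))) ≤ C
  infty : ∃ C : ℝ, 0 < C ∧ ∀ x y : Qpn p n,
    |q x - q y| ≤ C / Real.logb p (p + min ‖x‖ ‖y‖)

/-- The modular `∫ (|f(x)| / η)^{q(x)} dx`, with values in `[0, ∞]`. -/
noncomputable def modular {E : Type*} [ENorm E] (q : Qpn p n → ℝ) (f : Qpn p n → E) (η : ℝ≥0) :
    ℝ≥0∞ :=
  ∫⁻ x, (‖f x‖ₑ / (η : ℝ≥0∞)) ^ (q x) ∂(haar p n)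

/-- Membership in `L^{q(·)}(ℚ_p^n)`, for functions with values in `ℝ` or in `[0, ∞]`. -/
def MemVarLp {E : Type*} [ENorm E] [MeasurableSpace E] (q : Qpn p n → ℝ) (f : Qpn p n → E) :
    Prop :=
  AEMeasurable f (haar p n) ∧ ∃ η : ℝ≥0, 0 < η ∧ modular q f η < ∞

/-- The Luxemburg norm of `L^{q(·)}(ℚ_p^n)`, equal to `∞` if no `η` is admissible. -/
noncomputable def varNorm {E : Type*} [ENorm E] (q : Qpn p n → ℝ) (f : Qpn p n → E) : ℝ≥0∞ :=
  ⨅ (η : ℝ≥0) (_ : 0 < η ∧ modular q f η ≤ 1), (η : ℝ≥0∞)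

/-- Boundedness from `L^{r(·)}(ℚ_p^n)` to `L^{q(·)}(ℚ_p^n)` of an operator with values in
`[0, ∞]`-valued functions. -/
def IsBoundedOp (r q : Qpn p n → ℝ) (T : (Qpn p n → ℝ) → Qpn p n → ℝ≥0∞) : Prop :=
  ∃ C : ℝ≥0, ∀ f : Qpn p n → ℝ, MemVarLp r f →
    MemVarLp q (T f) ∧ varNorm q (T f) ≤ C * varNorm r f

/-- The norm `sup_{x ≠ y} |f(x) - f(y)| / |x - y|_p^β`. -/
noncomputable def lipNorm (β : ℝ) (f : Qpn p n → ℝ) : ℝ≥0∞ :=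
  ⨆ (x : Qpn p n) (y : Qpn p n) (_ : x ≠ y), ‖f x - f y‖ₑ / ‖x - y‖ₑ ^ β

/-- The homogeneous Lipschitz space `Λ_β(ℚ_p^n)`, as a set of functions. -/
def MemLip (β : ℝ) (f : Qpn p n → ℝ) : Prop :=
  Measurable f ∧ lipNorm β f < ∞

/-- The maximal commutator
`M_{α,b}(f)(x) = sup_γ |B_γ(x)|^{-(1 - α/n)} ∫_{B_γ(x)} |b(x) - b(y)| |f(y)| dy`. -/
noncomputable def maxCommutator (α : ℝ) (b f : Qpn p n → ℝ) (x : Qpn p n) : ℝ≥0∞ :=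
  ⨆ γ : ℤ, (haar p n (pball γ x) ^ (1 - α / n))⁻¹ *
    ∫⁻ y in pball γ x, ‖b x - b y‖ₑ * ‖f y‖ₑ ∂(haar p n)

/-- The supremum over all balls `B` of `|B|^{-β/n} ‖(b - b_B) χ_B‖_{q(·)} / ‖χ_B‖_{q(·)}`, where
`b_B` is the mean of `b` over `B`. -/
noncomputable def meanOsc (β : ℝ) (q b : Qpn p n → ℝ) : ℝ≥0∞ :=
  ⨆ (γ : ℤ) (x : Qpn p n), (haar p n (pball γ x) ^ (β / n))⁻¹ *
    (varNorm q ((pball γ x).indicator fun y => b y - ⨍ z in pball γ x, b z ∂(haar p n)) /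
      varNorm q ((pball γ x).indicator fun _ => (1 : ℝ)))

/-- The pairs `r(·), q(·) ∈ 𝒞^log(ℚ_p^n)` with `r(·) ∈ 𝒫(ℚ_p^n)`, `r_+ < n / s` and
`1 / q(·) = 1 / r(·) - s / n`. -/
structure IsAdmissible (s : ℝ) (r q : Qpn p n → ℝ) : Prop where
  logHolder_left : IsLogHolder r
  logHolder_right : IsLogHolder q
  isExponent : IsExponent r
  essSup_lt : essSup r (haar p n) < n / s
  rel : ∀ x, 1 / q x = 1 / r x - s / n

end Spaces

end PadicVarLebesgue

/-!
If `b` is Lipschitz of order `β`, then `M_{α,b} f` is at most `‖b‖_{Λ_β}` times the fractional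
maximal function of order `α + β`, so `L^{r(·)} → L^{q(·)}` boundedness comes down to the latter.
There Hedberg interpolation, with the bound `O(1 / |B|)` on the `r(x)`-th power of the mean over
`B`, reduces the `q(x)`-th power to the `r(x)`-th power of the Hardy–Littlewood maximal function.
Split `F = |f|` at height `1`. Where `F ≥ 1`, local log-Hölder continuity lets the exponent vary
within a ball at the cost of a constant; where `F ≤ 1`, the decay condition replaces the exponent
by its limit at infinity up to an integrable error. Both cases then rest on the constant-exponent
Hardy–Littlewood inequality, which is elementary since balls are disjoint or nested.

Conversely, testing `M_{α,b}` on `χ_B` gives `(*)`, because `‖χ_B‖_{r(·)}` is at most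
`2 |B|^{(α+β)/n} ‖χ_B‖_{q(·)}`. As averaging over `B` is bounded on `L^{q(·)}`, `(*)` implies the
Campanato condition: the mean oscillation of `b` over `B` is `O(|B|^{β/n})`. The means of `b` over
balls shrinking to `x` then form a geometric Cauchy sequence; their limit is Lipschitz of order `β`
in `x` and equals `b` almost everywhere by Lebesgue differentiation.
-/

open Filter
open scoped Topology

namespace PadicVarLebesgue

section ENNRealPowers

variable {a b c V A X K : ℝ≥0∞} {r q s θ ρ σ : ℝ}

lemma div_rpow_le_rpow_div (hc : 1 ≤ c) (hs : 1 ≤ s) : (a / c) ^ s ≤ a ^ s / c := by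
  rw [ENNReal.div_rpow_of_nonneg _ _ (zero_le_one.trans hs)]
  exact ENNReal.div_le_div_left (ENNReal.le_rpow_self_of_one_le hc hs) _

lemma div_coe_mul_coe (a : ℝ≥0∞) (b c : ℝ≥0) : a / (b * c) = a / b / c := by
  simp only [div_eq_mul_inv, mul_assoc,
    ENNReal.mul_inv (Or.inr ENNReal.coe_ne_top) (Or.inl ENNReal.coe_ne_top)]

lemma rpow_mul_rpow_one_sub_le_add (hθ₀ : 0 ≤ θ) (hθ₁ : θ ≤ 1) :
    a ^ θ * b ^ (1 - θ) ≤ a + b :=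
  calc a ^ θ * b ^ (1 - θ) ≤ max a b ^ θ * max a b ^ (1 - θ) := by
        have := sub_nonneg.2 hθ₁
        gcongr
        exacts [le_max_left a b, le_max_right a b]
    _ = max a b := by
        rw [← ENNReal.rpow_add_of_nonneg _ _ hθ₀ (sub_nonneg.2 hθ₁), add_sub_cancel,
          ENNReal.rpow_one]
    _ ≤ a + b := max_le le_self_add le_add_self

lemma mul_rpow_rpow_le_add (hr : 0 < r) (hq : 0 < q) (hσ : 0 ≤ σ) (hrel : 1 / q = 1 / r - σ) :
    (a * b ^ σ) ^ r ≤ a ^ q + b := by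
  have hrq : σ * r = 1 - r / q := by
    field_simp at hrel ⊢
    linarith
  calc (a * b ^ σ) ^ r = (a ^ q) ^ (r / q) * b ^ (1 - r / q) := by
        rw [ENNReal.mul_rpow_of_nonneg _ _ hr.le, ← ENNReal.rpow_mul, ← ENNReal.rpow_mul,
          mul_div_cancel₀ _ hq.ne', hrq]
    _ ≤ a ^ q + b := rpow_mul_rpow_one_sub_le_add (by positivity)
        (sub_nonneg.1 (hrq ▸ mul_nonneg hσ hr.le))

-- Since `q = r + r (σ q)`, the factor `A ^ (r σ q)` left over from `A ^ q` absorbs `V ^ (σ q)`.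
lemma rpow_mul_rpow_le_of_rpow_le_div (hV₀ : V ≠ 0) (hV : V ≠ ∞) (hr : 0 < r) (hq : 0 < q)
    (hσ : 0 ≤ σ) (hrel : 1 / q = 1 / r - σ) (hA : A ^ r ≤ K / V) :
    (V ^ σ * A) ^ q ≤ K ^ (σ * q) * A ^ r := by
  have hσq : 0 ≤ σ * q := by positivity
  have hsplit : q = r * (σ * q) + r := by
    field_simp at hrel
    linarith
  calc (V ^ σ * A) ^ q = V ^ (σ * q) * A ^ (r * (σ * q) + r) := by
        rw [ENNReal.mul_rpow_of_nonneg _ _ hq.le, ← ENNReal.rpow_mul V, ← hsplit]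
    _ = (V * A ^ r) ^ (σ * q) * A ^ r := by
        rw [ENNReal.rpow_add_of_nonneg _ _ (by positivity) hr.le, ENNReal.rpow_mul A r, ← mul_assoc,
          ENNReal.mul_rpow_of_nonneg _ _ hσq]
    _ ≤ (V * (K / V)) ^ (σ * q) * A ^ r := by gcongr
    _ = K ^ (σ * q) * A ^ r := by rw [ENNReal.mul_div_cancel hV₀ hV]

lemma rpow_le_mul_of_rpow_le (hρ : 1 ≤ ρ) (hρs : ρ ≤ s) (hK : 1 ≤ K) (hA : A ^ ρ ≤ X)
    (hX : X ^ (s - ρ) ≤ K) : A ^ s ≤ K * X := by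
  have hρ₀ : 0 < ρ := zero_lt_one.trans_le hρ
  have hsρ : 0 ≤ (s - ρ) / ρ := div_nonneg (sub_nonneg.2 hρs) hρ₀.le
  calc A ^ s = (A ^ ρ) ^ (1 + (s - ρ) / ρ) := by
        rw [← ENNReal.rpow_mul]
        congr 1
        field_simp
        ring
    _ ≤ X ^ (1 + (s - ρ) / ρ) := by gcongr
    _ = (X ^ (s - ρ)) ^ ρ⁻¹ * X := by
        rw [ENNReal.rpow_add_of_nonneg _ _ zero_le_one hsρ, ENNReal.rpow_one, mul_comm,
          div_eq_mul_inv, ENNReal.rpow_mul]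
    _ ≤ K ^ ρ⁻¹ * X := by gcongr
    _ ≤ K ^ (1 : ℝ) * X := by
        gcongr
        exact inv_le_one_of_one_le₀ hρ
    _ = K * X := by rw [ENNReal.rpow_one]

end ENNRealPowers

section MeasureSpace

variable {Ω : Type*} [MeasurableSpace Ω] {μ : Measure Ω}

lemma lintegral_rpow_le_lintegral_rpow (hμ : μ Set.univ ≤ 1) {f : Ω → ℝ≥0∞}
    (hf : AEMeasurable f μ) {P : ℝ} (hP : 1 ≤ P) : (∫⁻ x, f x ∂μ) ^ P ≤ ∫⁻ x, f x ^ P ∂μ := by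
  have hP₀ : 0 < P := zero_lt_one.trans_le hP
  have h : ∫⁻ x, f x ∂μ ≤ (∫⁻ x, f x ^ P ∂μ) ^ P⁻¹ := by
    have := eLpNorm'_le_eLpNorm'_mul_rpow_measure_univ zero_lt_one hP hf.aestronglyMeasurable
    simp only [eLpNorm', enorm_eq_self, ENNReal.rpow_one, one_div, inv_one] at this
    exact this.trans (mul_le_of_le_one_right' (ENNReal.rpow_le_one hμ
      (sub_nonneg.2 (inv_le_one_of_one_le₀ hP))))
  calc (∫⁻ x, f x ∂μ) ^ P ≤ ((∫⁻ x, f x ^ P ∂μ) ^ P⁻¹) ^ P := by gcongr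
    _ = ∫⁻ x, f x ^ P ∂μ := ENNReal.rpow_inv_rpow hP₀.ne' _

lemma laverage_rpow_le_laverage_rpow {f : Ω → ℝ≥0∞} (hf : AEMeasurable f μ) {P : ℝ}
    (hP : 1 ≤ P) : (⨍⁻ x, f x ∂μ) ^ P ≤ ⨍⁻ x, f x ^ P ∂μ := by
  refine lintegral_rpow_le_lintegral_rpow ?_ (hf.smul_measure _) hP
  rw [Measure.smul_apply, smul_eq_mul]
  exact ENNReal.inv_mul_le_one _

lemma enorm_sub_average_le_laverage {E : Type*} [NormedAddCommGroup E] [NormedSpace ℝ E]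
    [CompleteSpace E] [IsFiniteMeasure μ] [NeZero μ] {f : Ω → E} (hf : Integrable f μ) (c : E) :
    ‖c - ⨍ y, f y ∂μ‖ₑ ≤ ⨍⁻ y, ‖c - f y‖ₑ ∂μ := by
  have h : c - ⨍ y, f y ∂μ = ⨍ y, (c - f y) ∂μ := by
    nth_rewrite 1 [← average_const μ c]
    exact (integral_sub (integrable_const c) hf.to_average).symm
  rw [h]
  exact enorm_integral_le_lintegral_enorm _

lemma setLIntegral_ofReal_rpow_Ioi_eq_top (s : ℝ) :
    ∫⁻ t in Set.Ioi (0 : ℝ), ENNReal.ofReal (t ^ s) = ∞ := by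
  by_contra h
  refine not_integrableOn_Ioi_rpow s ((lintegral_ofReal_ne_top_iff_integrable
    (by fun_prop) ?_).1 h)
  filter_upwards [ae_restrict_mem measurableSet_Ioi] with t ht
  exact Real.rpow_nonneg (le_of_lt ht) s

lemma lintegral_rpow_eq_lintegral_meas_lt {g : Ω → ℝ≥0∞} (hg : AEMeasurable g μ) {P : ℝ}
    (hP : 0 < P) :
    ∫⁻ x, g x ^ P ∂μ = ENNReal.ofReal P *
      ∫⁻ t in Set.Ioi (0 : ℝ), μ {x | ENNReal.ofReal t < g x} * ENNReal.ofReal (t ^ (P - 1)) := by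
  by_cases hfin : ∀ᵐ x ∂μ, g x ≠ ∞
  · rw [← setLIntegral_congr_fun measurableSet_Ioi fun t (ht : 0 < t) => ?_,
      ← lintegral_rpow_eq_lintegral_meas_lt_mul μ (ae_of_all _ fun x => ENNReal.toReal_nonneg)
        hg.ennreal_toReal hP]
    · refine lintegral_congr_ae ?_
      filter_upwards [hfin] with x hx
      rw [← ENNReal.ofReal_rpow_of_nonneg ENNReal.toReal_nonneg hP.le, ENNReal.ofReal_toReal hx]
    · congr 1
      refine measure_congr (Filter.Eventually.set_eq ?_)
      filter_upwards [hfin] with x hx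
      exact (ENNReal.ofReal_lt_iff_lt_toReal ht.le hx).symm
  · have htop : μ {x | g x = ∞} ≠ 0 := by simpa [ae_iff] using hfin
    rw [lintegral_eq_top_of_measure_eq_top_ne_zero (hg.pow_const P) (by simpa [hP, hP.not_gt]),
      eq_comm, ENNReal.mul_eq_top]
    refine Or.inl ⟨by simpa, top_le_iff.1 ?_⟩
    calc ∞ = ∫⁻ t in Set.Ioi (0 : ℝ), μ {x | g x = ∞} * ENNReal.ofReal (t ^ (P - 1)) := by
          rw [lintegral_const_mul _ (by fun_prop), setLIntegral_ofReal_rpow_Ioi_eq_top,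
            ENNReal.mul_top htop]
      _ ≤ _ := by
          gcongr with t x
          exact fun hx => hx ▸ ENNReal.ofReal_lt_top

-- The distribution function of `G` is compared with that of `c * F` under the measure `F μ`, for
-- which the layer-cake formula lowers the exponent by one.
theorem lintegral_rpow_le_of_meas_lt_le {F G : Ω → ℝ≥0∞} (hF : Measurable F)
    (hG : AEMeasurable G μ) {c : ℝ≥0∞} (hc : c ≠ ∞) {P : ℝ} (hP : 1 < P)
    (h : ∀ t : ℝ, 0 < t → μ {x | ENNReal.ofReal t < G x} ≤
      c / ENNReal.ofReal t * μ.withDensity F {x | ENNReal.ofReal t < c * F x}) :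
    ∫⁻ x, G x ^ P ∂μ ≤ ENNReal.ofReal (P / (P - 1)) * ∫⁻ x, (c * F x) ^ P ∂μ := by
  have hP₀ : 0 < P := zero_lt_one.trans hP
  have hP₁ : 0 < P - 1 := sub_pos.2 hP
  set I := ∫⁻ t in Set.Ioi (0 : ℝ),
    μ.withDensity F {x | ENNReal.ofReal t < c * F x} * ENNReal.ofReal (t ^ (P - 1 - 1)) with hI
  have hGI : ∫⁻ x, G x ^ P ∂μ ≤ ENNReal.ofReal P * (c * I) := by
    rw [lintegral_rpow_eq_lintegral_meas_lt hG hP₀, hI, ← lintegral_const_mul' _ _ hc]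
    refine mul_le_mul_right (setLIntegral_mono' measurableSet_Ioi fun t (ht : 0 < t) => ?_) _
    have htP : ENNReal.ofReal (t ^ (P - 1)) / ENNReal.ofReal t =
        ENNReal.ofReal (t ^ (P - 1 - 1)) := by
      rw [← ENNReal.ofReal_div_of_pos ht, Real.rpow_sub_one ht.ne' (P - 1)]
    calc _ ≤ c / ENNReal.ofReal t * μ.withDensity F {x | ENNReal.ofReal t < c * F x} *
          ENNReal.ofReal (t ^ (P - 1)) := by gcongr; exact h t ht
      _ = _ := by rw [← htP]; simp only [div_eq_mul_inv]; ring
  have hFI : c * (ENNReal.ofReal (P - 1) * I) = ∫⁻ x, (c * F x) ^ P ∂μ := by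
    rw [hI, ← lintegral_rpow_eq_lintegral_meas_lt (hF.const_mul c).aemeasurable hP₁,
      lintegral_withDensity_eq_lintegral_mul _ hF (by fun_prop), ← lintegral_const_mul' _ _ hc]
    refine lintegral_congr fun x => ?_
    rw [Pi.mul_apply, ← mul_assoc]
    nth_rewrite 1 [← ENNReal.rpow_one (c * F x)]
    rw [← ENNReal.rpow_add_of_nonneg _ _ zero_le_one hP₁.le, add_sub_cancel]
  refine hGI.trans_eq ?_
  rw [← hFI, ENNReal.ofReal_div_of_pos hP₁, mul_left_comm c, ← mul_assoc (_ / _),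
    ENNReal.div_mul_cancel (by simpa using hP) ENNReal.ofReal_ne_top]

end MeasureSpace

section Balls

variable {p : ℕ} [Fact p.Prime] {n : ℕ}

lemma one_lt_prime : (1 : ℝ) < p := by exact_mod_cast (Fact.out : p.Prime).one_lt

lemma prime_pos : (0 : ℝ) < p := zero_lt_one.trans one_lt_prime

lemma zpow_prime_pos (γ : ℤ) : (0 : ℝ) < (p : ℝ) ^ γ := zpow_pos prime_pos γ

lemma prime_ennreal_ne_zero : (p : ℝ≥0∞) ≠ 0 := by
  exact_mod_cast (Fact.out : p.Prime).ne_zero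

lemma one_le_prime_ennreal : (1 : ℝ≥0∞) ≤ p := by
  exact_mod_cast (Fact.out : p.Prime).one_lt.le

instance instIsAddHaarMeasureHaar : (haar p n).IsAddHaarMeasure :=
  inferInstanceAs (Measure.addHaarMeasure _).IsAddHaarMeasure

instance instSigmaFiniteHaar : SigmaFinite (haar p n) :=
  inferInstanceAs (SigmaFinite (Measure.addHaarMeasure _))

lemma mem_pball {γ : ℤ} {x y : Qpn p n} : y ∈ pball γ x ↔ ‖y - x‖ ≤ (p : ℝ) ^ γ := by
  rw [pball, mem_closedBall_iff_norm]

lemma mem_pball_iff_forall {γ : ℤ} {x y : Qpn p n} :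
    y ∈ pball γ x ↔ ∀ j, ‖y j - x j‖ ≤ (p : ℝ) ^ γ := by
  rw [mem_pball, pi_norm_le_iff_of_nonneg (zpow_prime_pos γ).le]
  rfl

lemma mem_pball_self (γ : ℤ) (x : Qpn p n) : x ∈ pball γ x :=
  Metric.mem_closedBall_self (zpow_prime_pos γ).le

lemma pball_eq_of_mem {γ : ℤ} {x y : Qpn p n} (h : y ∈ pball γ x) : pball γ y = pball γ x :=
  (IsUltrametricDist.closedBall_eq_of_mem h).symm

lemma mem_pball_comm {γ : ℤ} {x y : Qpn p n} : y ∈ pball γ x ↔ x ∈ pball γ y :=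
  Metric.mem_closedBall_comm

lemma pball_mono {γ δ : ℤ} (h : γ ≤ δ) (x : Qpn p n) : pball γ x ⊆ pball δ x :=
  Metric.closedBall_subset_closedBall (zpow_le_zpow_right₀ one_lt_prime.le h)

lemma isOpen_pball (γ : ℤ) (x : Qpn p n) : IsOpen (pball γ x) :=
  IsUltrametricDist.isOpen_closedBall x (zpow_prime_pos γ).ne'

lemma measurableSet_pball (γ : ℤ) (x : Qpn p n) : MeasurableSet (pball γ x) :=
  (isOpen_pball γ x).measurableSet

lemma isCompact_pball (γ : ℤ) (x : Qpn p n) : IsCompact (pball γ x) :=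
  isCompact_closedBall _ _

lemma measurableSet_setOf_mem_pball (γ : ℤ) :
    MeasurableSet {z : Qpn p n × Qpn p n | z.2 ∈ pball γ z.1} :=
  (isClosed_le (continuous_snd.dist continuous_fst) continuous_const).measurableSet

lemma haar_pball_ne_zero (γ : ℤ) (x : Qpn p n) : haar p n (pball γ x) ≠ 0 :=
  (isOpen_pball γ x).measure_ne_zero _ ⟨x, mem_pball_self γ x⟩

lemma haar_pball_ne_top (γ : ℤ) (x : Qpn p n) : haar p n (pball γ x) ≠ ∞ :=
  (isCompact_pball γ x).measure_lt_top.ne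

lemma measurable_of_const_on_pball {E : Type*} [MeasurableSpace E] {γ : ℤ} {g : Qpn p n → E}
    (h : ∀ x, ∀ y ∈ pball γ x, g y = g x) : Measurable g := by
  have hg : IsLocallyConstant g := (IsLocallyConstant.iff_exists_open g).2 fun x =>
    ⟨pball γ x, isOpen_pball γ x, mem_pball_self γ x, h x⟩
  exact fun s _ => (hg s).measurableSet

lemma haar_pball_eq_haar_pball_zero (γ : ℤ) (x : Qpn p n) :
    haar p n (pball γ x) = haar p n (pball γ 0) := by
  have : pball γ (0 : Qpn p n) = (fun y => x + y) ⁻¹' pball γ x := by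
    ext y
    simp [mem_pball]
  rw [this, measure_preimage_add]

/-- The reference point of the residue class `c` in the ball of radius `p ^ γ` around `0`: the
numbers `0, …, p - 1`, scaled by `p ^ (-γ)`, represent that ball modulo the ball of radius
`p ^ (γ - 1)`. -/
noncomputable def residuePoint (γ : ℤ) (c : Fin n → Fin p) : Qpn p n :=
  fun j => ((c j : ℕ) : ℚ_[p]) * (p : ℚ_[p]) ^ (-γ)

lemma norm_mul_zpow_le_one_iff {γ : ℤ} {z : ℚ_[p]} :
    ‖z * (p : ℚ_[p]) ^ γ‖ ≤ 1 ↔ ‖z‖ ≤ (p : ℝ) ^ γ := by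
  rw [norm_mul, Padic.norm_p_zpow, zpow_neg, ← div_eq_mul_inv, div_le_one (zpow_prime_pos γ)]

lemma norm_sub_mul_zpow_neg_le_iff {γ : ℤ} {a z : ℚ_[p]} :
    ‖z - a * (p : ℚ_[p]) ^ (-γ)‖ ≤ (p : ℝ) ^ (γ - 1) ↔ ‖z * (p : ℚ_[p]) ^ γ - a‖ < 1 := by
  have hp : (p : ℚ_[p]) ≠ 0 := by exact_mod_cast (Fact.out : p.Prime).ne_zero
  have h : z * (p : ℚ_[p]) ^ γ - a = (z - a * (p : ℚ_[p]) ^ (-γ)) * (p : ℚ_[p]) ^ γ := by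
    rw [sub_mul, mul_assoc, ← zpow_add₀ hp, neg_add_cancel, zpow_zero, mul_one]
  rw [Padic.norm_le_pow_iff_norm_lt_pow_add_one, sub_add_cancel, h, norm_mul, Padic.norm_p_zpow,
    zpow_neg (p : ℝ), ← div_eq_mul_inv _ ((p : ℝ) ^ γ), div_lt_one (zpow_prime_pos γ)]

lemma mem_pball_residuePoint_iff {γ : ℤ} {c : Fin n → Fin p} {x : Qpn p n} :
    x ∈ pball (γ - 1) (residuePoint γ c) ↔
      ∀ j, ‖x j * (p : ℚ_[p]) ^ γ - ((c j : ℕ) : ℚ_[p])‖ < 1 := by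
  simp only [mem_pball_iff_forall, residuePoint, norm_sub_mul_zpow_neg_le_iff]

lemma exists_norm_sub_natCast_lt_one {z : ℚ_[p]} (hz : ‖z‖ ≤ 1) :
    ∃ c : Fin p, ‖z - ((c : ℕ) : ℚ_[p])‖ < 1 := by
  obtain ⟨m, hm, hzm⟩ := PadicInt.exists_mem_range (⟨z, hz⟩ : ℤ_[p])
  rw [PadicInt.maximalIdeal_eq_span_p, Ideal.mem_span_singleton, ← PadicInt.norm_lt_one_iff_dvd,
    PadicInt.norm_def] at hzm
  exact ⟨⟨m, hm⟩, hzm⟩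

lemma pball_zero_eq_iUnion_residuePoint (γ : ℤ) :
    pball γ (0 : Qpn p n) = ⋃ c : Fin n → Fin p, pball (γ - 1) (residuePoint γ c) := by
  ext x
  simp only [Set.mem_iUnion, mem_pball_residuePoint_iff]
  rw [mem_pball_iff_forall]
  simp only [Pi.zero_apply, sub_zero, ← norm_mul_zpow_le_one_iff]
  constructor
  · intro h
    choose c hc using fun j => exists_norm_sub_natCast_lt_one (h j)
    exact ⟨c, hc⟩
  · rintro ⟨c, hc⟩ j
    have hcj : ‖((c j : ℕ) : ℚ_[p])‖ ≤ 1 := by exact_mod_cast Padic.norm_int_le_one (c j : ℕ)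
    have := IsUltrametricDist.norm_add_le_max (x j * (p : ℚ_[p]) ^ γ - (c j : ℕ)) (c j : ℕ)
    rw [sub_add_cancel] at this
    exact this.trans (max_le (hc j).le hcj)

lemma pairwise_disjoint_pball_residuePoint (γ : ℤ) :
    Pairwise (Function.onFun Disjoint
      fun c : Fin n → Fin p => pball (γ - 1) (residuePoint γ c)) := by
  refine fun c d hcd => Set.disjoint_left.2 fun x hxc hxd => hcd (funext fun j => ?_)
  rw [mem_pball_residuePoint_iff] at hxc hxd
  have h : ‖(((d j : ℕ) : ℤ) - ((c j : ℕ) : ℤ) : ℤ_[p])‖ < 1 := by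
    have := IsUltrametricDist.norm_add_le_max (x j * (p : ℚ_[p]) ^ γ - (c j : ℕ))
      (-(x j * (p : ℚ_[p]) ^ γ - (d j : ℕ)))
    rw [norm_neg, ← sub_eq_add_neg, sub_sub_sub_cancel_left] at this
    rw [PadicInt.norm_def]
    push_cast
    exact this.trans_lt (max_lt (hxc j) (hxd j))
  rw [← Int.cast_sub, PadicInt.norm_int_lt_one_iff_dvd] at h
  have := Int.eq_zero_of_abs_lt_dvd h (by rw [abs_lt]; omega)
  omega

lemma haar_pball_eq_mul_haar_pball_sub_one (γ : ℤ) (x : Qpn p n) :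
    haar p n (pball γ x) = (p : ℝ≥0∞) ^ n * haar p n (pball (γ - 1) x) := by
  rw [haar_pball_eq_haar_pball_zero, pball_zero_eq_iUnion_residuePoint,
    measure_iUnion (pairwise_disjoint_pball_residuePoint γ) fun c => measurableSet_pball _ _]
  simp_rw [haar_pball_eq_haar_pball_zero (γ - 1)]
  simp [tsum_fintype]

theorem haar_pball (γ : ℤ) (x : Qpn p n) :
    haar p n (pball γ x) = (p : ℝ≥0∞) ^ ((n : ℝ) * γ) := by
  have hp := prime_ennreal_ne_zero (p := p)
  have hstep (k : ℤ) : (p : ℝ≥0∞) ^ ((n : ℝ) * (k : ℝ)) =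
      (p : ℝ≥0∞) ^ n * (p : ℝ≥0∞) ^ ((n : ℝ) * ((k - 1 : ℤ) : ℝ)) := by
    rw [← ENNReal.rpow_natCast, ← ENNReal.rpow_add _ _ hp (ENNReal.natCast_ne_top p)]
    congr 1
    push_cast
    ring
  induction γ using Int.induction_on with
  | zero =>
    rw [haar_pball_eq_haar_pball_zero, haar]
    simpa using! Measure.addHaarMeasure_self (K₀ := unitBall p n)
  | succ k ih =>
    rw [haar_pball_eq_mul_haar_pball_sub_one, hstep]
    simpa using congrArg (fun t => (p : ℝ≥0∞) ^ n * t) ih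
  | pred k ih =>
    rw [haar_pball_eq_mul_haar_pball_sub_one, hstep] at ih
    exact (ENNReal.mul_right_inj (pow_ne_zero _ hp)
      (ENNReal.pow_ne_top (ENNReal.natCast_ne_top p))).1 ih

lemma haar_pball_rpow_div (hn : n ≠ 0) (γ : ℤ) (x : Qpn p n) (s : ℝ) :
    haar p n (pball γ x) ^ (s / n) = (p : ℝ≥0∞) ^ (γ * s) := by
  rw [haar_pball, ← ENNReal.rpow_mul]
  congr 1
  field_simp

instance instIsUnifLocDoublingMeasureHaar : IsUnifLocDoublingMeasure (haar p n) where
  exists_measure_closedBall_le_mul'' := by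
    refine ⟨(p : ℝ≥0) ^ n * (p : ℝ≥0) ^ n, ?_⟩
    filter_upwards [self_mem_nhdsWithin] with ε hε x
    obtain ⟨γ, hγ₁, hγ₂⟩ := exists_mem_Ico_zpow hε (one_lt_prime (p := p))
    have hp₂ : (2 : ℝ) ≤ p := by exact_mod_cast (Fact.out : p.Prime).two_le
    calc haar p n (Metric.closedBall x (2 * ε)) ≤ haar p n (pball (γ + 1 + 1) x) := by
          refine measure_mono (Metric.closedBall_subset_closedBall ?_)
          rw [zpow_add_one₀ prime_pos.ne' (γ + 1), mul_comm]
          gcongr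
      _ = ((p : ℝ≥0∞) ^ n * (p : ℝ≥0∞) ^ n) * haar p n (pball γ x) := by
          simp only [haar_pball_eq_mul_haar_pball_sub_one (γ + 1 + 1),
            haar_pball_eq_mul_haar_pball_sub_one (γ + 1), mul_assoc, add_sub_cancel_right]
      _ ≤ _ := by
          push_cast
          gcongr
          exact Metric.closedBall_subset_closedBall hγ₁

lemma ofReal_prime_zpow (γ : ℤ) : ENNReal.ofReal ((p : ℝ) ^ γ) = (p : ℝ≥0∞) ^ (γ : ℝ) := by
  rw [← Real.rpow_intCast, ← ENNReal.ofReal_rpow_of_pos prime_pos, ENNReal.ofReal_natCast]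

lemma enorm_sub_le_of_mem_pball {γ : ℤ} {x y : Qpn p n} (h : y ∈ pball γ x) :
    ‖x - y‖ₑ ≤ (p : ℝ≥0∞) ^ (γ : ℝ) := by
  rw [mem_pball, norm_sub_rev] at h
  rw [← ofReal_norm, ← ofReal_prime_zpow]
  exact ENNReal.ofReal_le_ofReal h

lemma exists_norm_eq_zpow {x : Qpn p n} (hx : x ≠ 0) : ∃ γ : ℤ, ‖x‖ = (p : ℝ) ^ γ := by
  obtain ⟨i, -⟩ := Function.ne_iff.1 hx
  have : Nonempty (Fin n) := ⟨i⟩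
  obtain ⟨j, hj⟩ := Finite.exists_max fun j => ‖x j‖
  have hxj : ‖x‖ = ‖x j‖ :=
    le_antisymm ((pi_norm_le_iff_of_nonneg (norm_nonneg _)).2 hj) (norm_le_pi_norm x j)
  have hj₀ : x j ≠ 0 := norm_ne_zero_iff.1 (hxj ▸ norm_ne_zero_iff.2 hx)
  exact ⟨_, hxj.trans (Padic.norm_eq_zpow_neg_valuation hj₀)⟩

end Balls

section MaximalFunction

variable {p : ℕ} [Fact p.Prime] {n : ℕ} {F G : Qpn p n → ℝ≥0∞} {γ : ℤ} {x : Qpn p n} {σ : ℝ}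

/-- The mean of `F` over the ball of radius `p ^ γ` centred at `x`. -/
noncomputable def ballAvg (γ : ℤ) (F : Qpn p n → ℝ≥0∞) (x : Qpn p n) : ℝ≥0∞ :=
  ⨍⁻ y in pball γ x, F y ∂(haar p n)

/-- The fractional maximal function of order `n σ`, `sup_γ |B_γ(x)| ^ (σ - 1) ∫_{B_γ(x)} F`; the
case `σ = 0` is the Hardy–Littlewood maximal function. -/
noncomputable def fracMax (σ : ℝ) (F : Qpn p n → ℝ≥0∞) (x : Qpn p n) : ℝ≥0∞ :=
  ⨆ γ : ℤ, haar p n (pball γ x) ^ σ * ballAvg γ F x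

lemma ballAvg_eq_inv_mul (γ : ℤ) (F : Qpn p n → ℝ≥0∞) (x : Qpn p n) :
    ballAvg γ F x = (haar p n (pball γ x))⁻¹ * ∫⁻ y in pball γ x, F y ∂(haar p n) := by
  rw [ballAvg, setLAverage_eq, ENNReal.div_eq_inv_mul]

lemma fracMax_zero (F : Qpn p n → ℝ≥0∞) (x : Qpn p n) : fracMax 0 F x = ⨆ γ, ballAvg γ F x := by
  simp only [fracMax, ENNReal.rpow_zero, one_mul]

lemma rpow_mul_ballAvg_le_fracMax (σ : ℝ) (γ : ℤ) (F : Qpn p n → ℝ≥0∞) (x : Qpn p n) :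
    haar p n (pball γ x) ^ σ * ballAvg γ F x ≤ fracMax σ F x :=
  le_iSup (fun γ => haar p n (pball γ x) ^ σ * ballAvg γ F x) γ

lemma ballAvg_le_fracMax_zero (γ : ℤ) (F : Qpn p n → ℝ≥0∞) (x : Qpn p n) :
    ballAvg γ F x ≤ fracMax 0 F x :=
  (le_iSup (fun γ => ballAvg γ F x) γ).trans_eq (fracMax_zero F x).symm

lemma ballAvg_eq_of_mem {δ : ℤ} (h : γ ≤ δ) (F : Qpn p n → ℝ≥0∞) {y : Qpn p n}
    (hy : y ∈ pball γ x) : ballAvg δ F y = ballAvg δ F x := by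
  rw [ballAvg, pball_eq_of_mem (pball_mono h x hy), ballAvg]

lemma measurable_ballAvg (γ : ℤ) (F : Qpn p n → ℝ≥0∞) : Measurable (ballAvg γ F) :=
  measurable_of_const_on_pball fun _ _ hy => ballAvg_eq_of_mem le_rfl F hy

lemma measurable_ballAvg_of_uncurry (γ : ℤ) {H : Qpn p n → Qpn p n → ℝ≥0∞}
    (hH : Measurable (Function.uncurry H)) : Measurable fun x => ballAvg γ (H x) x := by
  simp only [ballAvg_eq_inv_mul, haar_pball, ← lintegral_indicator (measurableSet_pball γ _)]
  exact (hH.indicator (measurableSet_setOf_mem_pball γ)).lintegral_prod_right'.const_mul _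

lemma measurable_fracMax (σ : ℝ) (F : Qpn p n → ℝ≥0∞) : Measurable (fracMax σ F) :=
  Measurable.iSup fun γ => by
    simp only [haar_pball]
    exact (measurable_ballAvg γ F).const_mul _

lemma fracMax_congr_ae (h : F =ᵐ[haar p n] G) (σ : ℝ) : fracMax σ F = fracMax σ G := by
  funext x
  simp only [fracMax, ballAvg, laverage_congr (ae_restrict_of_ae h)]

lemma ballAvg_const (c : ℝ≥0∞) (γ : ℤ) (x : Qpn p n) :
    ballAvg γ (fun _ : Qpn p n => c) x = c :=
  setLAverage_const (haar_pball_ne_zero γ x) (haar_pball_ne_top γ x) c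

lemma ballAvg_le_mul_ballAvg {c : ℝ≥0∞} (hc : c ≠ ∞) (h : ∀ y ∈ pball γ x, F y ≤ c * G y) :
    ballAvg γ F x ≤ c * ballAvg γ G x := by
  rw [ballAvg_eq_inv_mul, ballAvg_eq_inv_mul, mul_left_comm, ← lintegral_const_mul' _ _ hc]
  exact mul_le_mul_right (setLIntegral_mono' (measurableSet_pball γ x) h) _

lemma ballAvg_add (hF : Measurable F) (G : Qpn p n → ℝ≥0∞) (γ : ℤ) (x : Qpn p n) :
    ballAvg γ (fun y => F y + G y) x = ballAvg γ F x + ballAvg γ G x :=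
  lintegral_add_left hF _

lemma fracMax_add_le (hF : Measurable F) (G : Qpn p n → ℝ≥0∞) (σ : ℝ) (x : Qpn p n) :
    fracMax σ (fun y => F y + G y) x ≤ fracMax σ F x + fracMax σ G x := by
  refine iSup_le fun γ => ?_
  rw [ballAvg_add hF, mul_add]
  exact add_le_add (rpow_mul_ballAvg_le_fracMax σ γ F x) (rpow_mul_ballAvg_le_fracMax σ γ G x)

lemma fracMax_const_mul {c : ℝ≥0∞} (hc : c ≠ ∞) (F : Qpn p n → ℝ≥0∞) (σ : ℝ) (x : Qpn p n) :
    fracMax σ (fun y => c * F y) x = c * fracMax σ F x := by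
  simp only [fracMax, ballAvg_eq_inv_mul, lintegral_const_mul' _ _ hc, ENNReal.mul_iSup]
  congr! 2 with γ
  ring

lemma ballAvg_le_lintegral_div (γ : ℤ) (F : Qpn p n → ℝ≥0∞) (x : Qpn p n) :
    ballAvg γ F x ≤ (∫⁻ y, F y ∂(haar p n)) / haar p n (pball γ x) := by
  rw [ballAvg, setLAverage_eq]
  gcongr
  exact Measure.restrict_le_self

lemma setLIntegral_setLIntegral_pball (hF : Measurable F) (γ : ℤ) (A : Set (Qpn p n)) :
    ∫⁻ x in A, ∫⁻ y in pball γ x, F y ∂(haar p n) ∂(haar p n) =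
      ∫⁻ y, F y * haar p n (pball γ y ∩ A) ∂(haar p n) := by
  set E := {z : Qpn p n × Qpn p n | z.2 ∈ pball γ z.1}
  calc ∫⁻ x in A, ∫⁻ y in pball γ x, F y ∂(haar p n) ∂(haar p n)
      = ∫⁻ x in A, ∫⁻ y, E.indicator (fun z => F z.2) (x, y) ∂(haar p n) ∂(haar p n) := by
        simp only [← lintegral_indicator (measurableSet_pball γ _)]
        rfl
    _ = ∫⁻ y, ∫⁻ x in A, E.indicator (fun z => F z.2) (x, y) ∂(haar p n) ∂(haar p n) :=
        lintegral_lintegral_swap ((hF.comp measurable_snd).indicator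
          (measurableSet_setOf_mem_pball γ)).aemeasurable
    _ = ∫⁻ y, ∫⁻ x in A, (pball γ y).indicator (fun _ => F y) x ∂(haar p n) ∂(haar p n) :=
        lintegral_congr fun y => lintegral_congr fun x =>
          Set.indicator_eq_indicator mem_pball_comm rfl
    _ = ∫⁻ y, F y * haar p n (pball γ y ∩ A) ∂(haar p n) := by
        simp only [lintegral_indicator_const (measurableSet_pball γ _),
          Measure.restrict_apply (measurableSet_pball γ _)]

lemma setLIntegral_ballAvg_eq {A : Set (Qpn p n)} (hA : MeasurableSet A)
    (hsat : ∀ x ∈ A, pball γ x ⊆ A) (hF : Measurable F) :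
    ∫⁻ x in A, ballAvg γ F x ∂(haar p n) = ∫⁻ x in A, F x ∂(haar p n) := by
  have hV₀ := haar_pball_ne_zero γ (0 : Qpn p n)
  simp only [ballAvg_eq_inv_mul, haar_pball_eq_haar_pball_zero γ]
  rw [lintegral_const_mul' _ _ (ENNReal.inv_ne_top.2 hV₀), setLIntegral_setLIntegral_pball hF,
    ← lintegral_const_mul' _ _ (ENNReal.inv_ne_top.2 hV₀), ← lintegral_indicator hA]
  refine lintegral_congr fun y => ?_
  by_cases hy : y ∈ A
  · rw [Set.inter_eq_left.2 (hsat y hy), Set.indicator_of_mem hy, haar_pball_eq_haar_pball_zero γ y,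
      mul_left_comm, ENNReal.inv_mul_cancel hV₀ (haar_pball_ne_top γ 0), mul_one]
  · have hdisj : pball γ y ∩ A = ∅ := Set.eq_empty_of_forall_notMem fun x hx =>
      hy (hsat x hx.2 (mem_pball_comm.1 hx.1))
    rw [hdisj, Set.indicator_of_notMem hy, measure_empty, mul_zero, mul_zero]

/-- The points `x` for which `p ^ γ` is the largest of the radii `p ^ δ`, `δ ≤ N`, with mean of `F`
over `B_δ(x)` exceeding `t`. As balls are nested or disjoint, for `γ ≤ N` this is a disjoint
union of balls of radius `p ^ γ`, the maximal ones in the Calderón–Zygmund decomposition; the bound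
`N` makes sure that a maximal ball exists. -/
def stoppingSet (F : Qpn p n → ℝ≥0∞) (t : ℝ≥0∞) (N γ : ℤ) : Set (Qpn p n) :=
  {x | t < ballAvg γ F x ∧ ∀ δ ∈ Set.Ioc γ N, ballAvg δ F x ≤ t}

variable {t : ℝ≥0∞} {N : ℤ}

lemma pball_subset_stoppingSet (hx : x ∈ stoppingSet F t N γ) :
    pball γ x ⊆ stoppingSet F t N γ := by
  refine fun y hy => ⟨(ballAvg_eq_of_mem le_rfl F hy).symm ▸ hx.1, fun δ hδ => ?_⟩
  exact (ballAvg_eq_of_mem hδ.1.le F hy).trans_le (hx.2 δ hδ)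

lemma measurableSet_stoppingSet : MeasurableSet (stoppingSet F t N γ) :=
  (isOpen_iff_mem_nhds.2 fun x hx => mem_of_superset
    ((isOpen_pball γ x).mem_nhds (mem_pball_self γ x)) (pball_subset_stoppingSet hx)).measurableSet

lemma pairwise_disjoint_stoppingSet (F : Qpn p n → ℝ≥0∞) (t : ℝ≥0∞) (N : ℤ) :
    Pairwise (Function.onFun Disjoint fun γ : Set.Iic N => stoppingSet F t N γ) := by
  intro γ δ hne
  refine Set.disjoint_left.2 fun x hxγ hxδ => ?_
  rcases lt_or_gt_of_ne hne with h | h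
  · exact (hxγ.2 δ ⟨h, δ.2⟩).not_gt hxδ.1
  · exact (hxδ.2 γ ⟨h, γ.2⟩).not_gt hxγ.1

lemma iUnion_stoppingSet (F : Qpn p n → ℝ≥0∞) (t : ℝ≥0∞) (N : ℤ) :
    ⋃ γ : Set.Iic N, stoppingSet F t N γ = {x | ∃ γ ≤ N, t < ballAvg γ F x} := by
  ext x
  rw [Set.mem_iUnion]
  constructor
  · rintro ⟨γ, hγ⟩
    exact ⟨γ, γ.2, hγ.1⟩
  · rintro hex
    obtain ⟨m, ⟨hmN, hm⟩, hmax⟩ := Int.exists_greatest_of_bdd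
      (P := fun γ => γ ≤ N ∧ t < ballAvg γ F x) ⟨N, fun _ h => h.1⟩ hex
    exact ⟨⟨m, hmN⟩, hm, fun δ hδ => not_lt.1 fun h => (hmax δ ⟨hδ.2, h⟩).not_gt hδ.1⟩

lemma mul_meas_exists_lt_ballAvg_le (hF : Measurable F) (t : ℝ≥0∞) (N : ℤ) :
    t * haar p n {x | ∃ γ ≤ N, t < ballAvg γ F x} ≤ ∫⁻ x, F x ∂(haar p n) := by
  have hdisj := pairwise_disjoint_stoppingSet F t N
  rw [← iUnion_stoppingSet]
  calc t * haar p n (⋃ γ : Set.Iic N, stoppingSet F t N γ)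
      = ∑' γ : Set.Iic N, t * haar p n (stoppingSet F t N γ) := by
        rw [measure_iUnion hdisj fun γ => measurableSet_stoppingSet, ENNReal.tsum_mul_left]
    _ ≤ ∑' γ : Set.Iic N, ∫⁻ x in stoppingSet F t N γ, F x ∂(haar p n) := by
        refine ENNReal.tsum_le_tsum fun γ => ?_
        rw [← setLIntegral_ballAvg_eq measurableSet_stoppingSet
          (fun x => pball_subset_stoppingSet) hF, ← setLIntegral_const]
        exact setLIntegral_mono (measurable_ballAvg _ F) fun x hx => hx.1.le
    _ = ∫⁻ x in ⋃ γ : Set.Iic N, stoppingSet F t N γ, F x ∂(haar p n) :=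
        (lintegral_iUnion (fun γ : Set.Iic N => measurableSet_stoppingSet) hdisj F).symm
    _ ≤ ∫⁻ x, F x ∂(haar p n) := setLIntegral_le_lintegral _ _

theorem mul_meas_lt_fracMax_zero_le (hF : Measurable F) (t : ℝ≥0∞) :
    t * haar p n {x | t < fracMax 0 F x} ≤ ∫⁻ x, F x ∂(haar p n) := by
  have hset : {x | t < fracMax 0 F x} = ⋃ N : ℤ, {x | ∃ γ ≤ N, t < ballAvg γ F x} := by
    ext x
    simp only [fracMax_zero, Set.mem_ofPred_eq, lt_iSup_iff, Set.mem_iUnion]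
    exact ⟨fun ⟨γ, h⟩ => ⟨γ, γ, le_rfl, h⟩, fun ⟨_, γ, _, h⟩ => ⟨γ, h⟩⟩
  have hmono : Monotone fun N : ℤ => {x | ∃ γ ≤ N, t < ballAvg γ F x} :=
    fun N N' h x ⟨γ, hγ, hx⟩ => ⟨γ, hγ.trans h, hx⟩
  rw [hset, hmono.measure_iUnion, ENNReal.mul_iSup]
  exact iSup_le (mul_meas_exists_lt_ballAvg_le hF t)

-- Half of the level `2 s` is lost to the part of `F` below `s`, which has mean at most `s`.
lemma meas_lt_fracMax_zero_le (hF : Measurable F) {s : ℝ≥0∞} (hs₀ : s ≠ 0) (hs : s ≠ ∞) :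
    haar p n {x | 2 * s < fracMax 0 F x} ≤ s⁻¹ * (haar p n).withDensity F {x | s < F x} := by
  have hE : MeasurableSet {x | s < F x} := measurableSet_lt measurable_const hF
  set F₁ := {x | s < F x}.indicator F
  have hF₁m : Measurable F₁ := hF.indicator hE
  have hle : ∀ x, F x ≤ F₁ x + s := by
    intro x
    by_cases h : s < F x
    · exact (Set.indicator_of_mem (s := {x | s < F x}) h F).symm.le.trans le_self_add
    · exact (not_lt.1 h).trans le_add_self
  have hsub : {x | 2 * s < fracMax 0 F x} ⊆ {x | s < fracMax 0 F₁ x} := by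
    intro x hx
    rw [Set.mem_ofPred_eq, fracMax_zero] at hx
    obtain ⟨γ, hγ⟩ := lt_iSup_iff.1 hx
    have havg : ballAvg γ F x ≤ ballAvg γ F₁ x + s :=
      calc ballAvg γ F x ≤ ballAvg γ (fun y => F₁ y + s) x := laverage_mono_ae (ae_of_all _ hle)
        _ = ballAvg γ F₁ x + s := by rw [ballAvg_add hF₁m, ballAvg_const]
    rw [two_mul] at hγ
    exact ((ENNReal.add_lt_add_iff_right hs).1 (hγ.trans_le havg)).trans_le
      (ballAvg_le_fracMax_zero γ F₁ x)
  rw [← ENNReal.div_eq_inv_mul, ENNReal.le_div_iff_mul_le (Or.inl hs₀) (Or.inl hs), mul_comm,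
    withDensity_apply _ hE, ← lintegral_indicator hE]
  exact (mul_le_mul_right (measure_mono hsub) _).trans (mul_meas_lt_fracMax_zero_le hF₁m s)

theorem exists_lintegral_fracMax_zero_rpow_le {P : ℝ} (hP : 1 < P) :
    ∃ C : ℝ≥0, ∀ F : Qpn p n → ℝ≥0∞, Measurable F →
      ∫⁻ x, fracMax 0 F x ^ P ∂(haar p n) ≤ C * ∫⁻ x, F x ^ P ∂(haar p n) := by
  have hP₀ : 0 ≤ P := zero_le_one.trans hP.le
  refine ⟨(P / (P - 1)).toNNReal * 2 ^ P, fun F hF => ?_⟩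
  calc ∫⁻ x, fracMax 0 F x ^ P ∂(haar p n)
      ≤ ENNReal.ofReal (P / (P - 1)) * ∫⁻ x, (2 * F x) ^ P ∂(haar p n) := by
        refine lintegral_rpow_le_of_meas_lt_le hF (measurable_fracMax 0 F).aemeasurable
          ENNReal.ofNat_ne_top hP fun t ht => ?_
        have h := meas_lt_fracMax_zero_le hF (s := ENNReal.ofReal t / 2) (by simpa using ht)
          (ENNReal.div_ne_top ENNReal.ofReal_ne_top two_ne_zero)
        rw [ENNReal.mul_div_cancel two_ne_zero ENNReal.ofNat_ne_top,
          ENNReal.inv_div (Or.inl ENNReal.ofNat_ne_top) (Or.inl two_ne_zero)] at h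
        simpa only [ENNReal.div_lt_iff (Or.inl two_ne_zero) (Or.inl ENNReal.ofNat_ne_top),
          mul_comm _ (2 : ℝ≥0∞)] using h
    _ = ((P / (P - 1)).toNNReal * 2 ^ P : ℝ≥0) * ∫⁻ x, F x ^ P ∂(haar p n) := by
        simp only [ENNReal.mul_rpow_of_nonneg _ _ hP₀]
        rw [lintegral_const_mul' _ _ (by simp), ← mul_assoc, ENNReal.coe_mul,
          ENNReal.coe_rpow_of_nonneg _ hP₀]
        rfl

end MaximalFunction

section Exponents

variable {p : ℕ} [Fact p.Prime] {n : ℕ} {q : Qpn p n → ℝ}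

lemma IsExponent.one_lt_apply (hq : IsExponent q) (x : Qpn p n) : 1 < q x :=
  hq.one_lt.trans_le (hq.essInf_le x)

lemma IsExponent.pos (hq : IsExponent q) (x : Qpn p n) : 0 < q x :=
  zero_lt_one.trans (hq.one_lt_apply x)

lemma IsExponent.one_le_essSup (hq : IsExponent q) : 1 ≤ essSup q (haar p n) :=
  (hq.one_lt_apply 0).le.trans (hq.le_essSup 0)

/-- The essential infimum `q_-(B_γ(x))` of the exponent over a ball. -/
noncomputable def ballInf (q : Qpn p n → ℝ) (γ : ℤ) (x : Qpn p n) : ℝ :=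
  essInf q ((haar p n).restrict (pball γ x))

/-- The essential supremum `q_+(B_γ(x))` of the exponent over a ball. -/
noncomputable def ballSup (q : Qpn p n → ℝ) (γ : ℤ) (x : Qpn p n) : ℝ :=
  essSup q ((haar p n).restrict (pball γ x))

lemma IsExponent.essInf_le_ballInf (hq : IsExponent q) (γ : ℤ) (x : Qpn p n) :
    essInf q (haar p n) ≤ ballInf q γ x := by
  have : NeZero ((haar p n).restrict (pball γ x)) :=
    ⟨fun h => haar_pball_ne_zero γ x (Measure.restrict_eq_zero.1 h)⟩
  have hbdd : IsBoundedUnder (· ≤ ·) (ae ((haar p n).restrict (pball γ x))) q :=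
    isBoundedUnder_of ⟨_, hq.le_essSup⟩
  exact le_essInf_of_ae_le _ (ae_of_all _ hq.essInf_le) hbdd.isCoboundedUnder_ge

lemma IsExponent.ae_restrict_mem_Icc (hq : IsExponent q) (γ : ℤ) (x : Qpn p n) :
    ∀ᵐ y ∂(haar p n).restrict (pball γ x), q y ∈ Set.Icc (ballInf q γ x) (ballSup q γ x) :=
  (ae_essInf_le (isBoundedUnder_of ⟨_, hq.essInf_le⟩)).and
    (ae_le_essSup (isBoundedUnder_of ⟨_, hq.le_essSup⟩))

-- For a fixed radius there are only countably many balls, so the exceptional sets add up to a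
-- null set.
lemma IsExponent.ae_forall_mem_Icc (hq : IsExponent q) :
    ∀ᵐ x ∂(haar p n), ∀ γ, q x ∈ Set.Icc (ballInf q γ x) (ballSup q γ x) := by
  have hdense : ∀ᵐ x ∂(haar p n), ∀ γ : ℤ, ∀ k : ℕ,
      x ∈ pball γ (TopologicalSpace.denseSeq (Qpn p n) k) →
        q x ∈ Set.Icc (ballInf q γ (TopologicalSpace.denseSeq (Qpn p n) k))
          (ballSup q γ (TopologicalSpace.denseSeq (Qpn p n) k)) :=
    ae_all_iff.2 fun γ => ae_all_iff.2 fun k =>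
      (ae_restrict_iff' (measurableSet_pball _ _)).1 (hq.ae_restrict_mem_Icc γ _)
  filter_upwards [hdense] with x hx γ
  obtain ⟨k, hk⟩ := (TopologicalSpace.denseRange_denseSeq (Qpn p n)).exists_mem_open
    (isOpen_pball γ x) ⟨x, mem_pball_self γ x⟩
  have h := hx γ k (mem_pball_comm.1 hk)
  rwa [ballInf, ballSup, pball_eq_of_mem hk] at h

lemma IsLogHolder.exists_inv_haar_pball_rpow_le (hq : IsLogHolder q) :
    ∃ K : ℝ≥0, 1 ≤ K ∧ ∀ᵐ x ∂(haar p n), ∀ γ,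
      ((haar p n (pball γ x))⁻¹) ^ (q x - ballInf q γ x) ≤ K := by
  obtain ⟨C, hC, hloc⟩ := hq.loc
  refine ⟨(p : ℝ≥0) ^ ((n : ℝ) * C), NNReal.one_le_rpow
    (by exact_mod_cast (Fact.out : p.Prime).one_lt.le) (by positivity), ?_⟩
  filter_upwards [hq.isExponent.ae_forall_mem_Icc] with x hx γ
  obtain ⟨hinf, hsup⟩ := hx γ
  have hbound : -(γ : ℝ) * (q x - ballInf q γ x) ≤ C := by
    rcases le_total (γ : ℝ) 0 with h | h
    · have := mul_le_mul_of_nonneg_left (sub_le_sub_right hsup (ballInf q γ x)) (neg_nonneg.2 h)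
      have hloc' : (γ : ℝ) * (ballInf q γ x - ballSup q γ x) ≤ C := hloc γ x
      linarith
    · linarith [mul_nonneg h (sub_nonneg.2 hinf)]
  calc ((haar p n (pball γ x))⁻¹) ^ (q x - ballInf q γ x)
      = (p : ℝ≥0∞) ^ ((n : ℝ) * (-(γ : ℝ) * (q x - ballInf q γ x))) := by
        rw [haar_pball, ← ENNReal.rpow_neg, ← ENNReal.rpow_mul]
        congr 1
        ring
    _ ≤ (p : ℝ≥0∞) ^ ((n : ℝ) * C) :=
        ENNReal.rpow_le_rpow_of_exponent_le one_le_prime_ennreal (by gcongr)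
    _ = ((p : ℝ≥0) ^ ((n : ℝ) * C) : ℝ≥0) := by
        rw [ENNReal.coe_rpow_of_nonneg _ (by positivity), ENNReal.coe_natCast]

/-- An integrable function, comparable to `(1 + |x|_p) ^ (-(n + 1))`, which dominates the error
made when a small number is raised to `q(x)` instead of the limit of `q` at infinity. It is written
as a series of indicators of balls so that its integral is a geometric series. -/
noncomputable def decayFun (p : ℕ) [Fact p.Prime] (n : ℕ) (x : Qpn p n) : ℝ≥0∞ :=
  ∑' k : ℕ, (pball (k : ℤ) (0 : Qpn p n)).indicator
    (fun _ => (p : ℝ≥0∞) ^ (-((k : ℝ) * (n + 1)))) x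

lemma measurable_decayFun : Measurable (decayFun p n) :=
  Measurable.tsum fun _ => measurable_const.indicator (measurableSet_pball _ _)

lemma lintegral_decayFun_lt_top : ∫⁻ x, decayFun p n x ∂(haar p n) < ∞ := by
  have hterm : ∀ k : ℕ, ∫⁻ x, (pball (k : ℤ) (0 : Qpn p n)).indicator
      (fun _ => (p : ℝ≥0∞) ^ (-((k : ℝ) * (n + 1)))) x ∂(haar p n) = ((p : ℝ≥0∞)⁻¹) ^ k := by
    intro k
    rw [lintegral_indicator_const (measurableSet_pball _ _), haar_pball,
      ← ENNReal.rpow_add _ _ prime_ennreal_ne_zero (ENNReal.natCast_ne_top p),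
      ← ENNReal.rpow_natCast, ← ENNReal.rpow_neg_one, ← ENNReal.rpow_mul]
    congr 1
    push_cast
    ring
  simp only [decayFun]
  rw [lintegral_tsum fun _ => (measurable_const.indicator (measurableSet_pball _ _)).aemeasurable]
  simp only [hterm, ENNReal.tsum_geometric]
  refine ENNReal.inv_lt_top.2 (tsub_pos_of_lt (ENNReal.inv_lt_one.2 ?_))
  exact_mod_cast (Fact.out : p.Prime).one_lt

lemma prime_rpow_neg_le_decayFun {k : ℕ} {y : Qpn p n} (hy : ‖y‖ ≤ (p : ℝ) ^ k) :
    (p : ℝ≥0∞) ^ (-((k : ℝ) * (n + 1))) ≤ decayFun p n y := by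
  have hmem : y ∈ pball (k : ℤ) (0 : Qpn p n) := by rwa [mem_pball, sub_zero, zpow_natCast]
  have h := ENNReal.le_tsum (f := fun k : ℕ => (pball (k : ℤ) (0 : Qpn p n)).indicator
    (fun _ => (p : ℝ≥0∞) ^ (-((k : ℝ) * (n + 1)))) y) k
  rwa [Set.indicator_of_mem hmem] at h

lemma rpow_le_rpow_add_decayFun {k : ℕ} {y : Qpn p n} (hy : ‖y‖ ≤ (p : ℝ) ^ k) {t : ℝ≥0∞}
    (ht : t ≤ 1) {a b M : ℝ} (ha : 1 ≤ a) (hab : k * |a - b| ≤ M) :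
    t ^ a ≤ (p : ℝ≥0∞) ^ (M * (n + 1)) * t ^ b + decayFun p n y := by
  set w : ℝ≥0∞ := (p : ℝ≥0∞) ^ (-((k : ℝ) * (n + 1))) with hw
  rcases le_total t w with h | h
  · calc t ^ a ≤ t := by simpa using ENNReal.rpow_le_rpow_of_exponent_ge ht ha
      _ ≤ decayFun p n y := h.trans (prime_rpow_neg_le_decayFun hy)
      _ ≤ _ := le_add_self
  · have ht₀ : t ≠ 0 := ((ENNReal.rpow_pos (pos_of_ne_zero prime_ennreal_ne_zero)
      (ENNReal.natCast_ne_top p)).trans_le h).ne'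
    calc t ^ a = t ^ (a - b) * t ^ b := by
          rw [← ENNReal.rpow_add _ _ ht₀ (ht.trans_lt ENNReal.one_lt_top).ne, sub_add_cancel]
      _ ≤ t ^ (-|a - b|) * t ^ b := by
          gcongr ?_ * _
          exact ENNReal.rpow_le_rpow_of_exponent_ge ht (neg_abs_le _)
      _ ≤ w ^ (-|a - b|) * t ^ b := by
          rw [ENNReal.rpow_neg, ENNReal.rpow_neg]
          gcongr
      _ = (p : ℝ≥0∞) ^ (k * |a - b| * (n + 1)) * t ^ b := by
          rw [hw, ← ENNReal.rpow_mul]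
          congr 2
          ring
      _ ≤ (p : ℝ≥0∞) ^ (M * (n + 1)) * t ^ b := by
          gcongr
          exact one_le_prime_ennreal
      _ ≤ _ := le_self_add

lemma exists_norm_le_pow_mul_le {C d : ℝ} {y : Qpn p n} (hC : 0 ≤ C)
    (hd : d ≤ C / Real.logb p (p + ‖y‖)) : ∃ k : ℕ, ‖y‖ ≤ (p : ℝ) ^ k ∧ k * d ≤ 2 * C := by
  have hp := one_lt_prime (p := p)
  have hy : 0 < p + ‖y‖ := add_pos_of_pos_of_nonneg prime_pos (norm_nonneg y)
  set L := Real.logb p (p + ‖y‖) with hL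
  have hL₁ : 1 ≤ L := by
    rw [hL, Real.le_logb_iff_rpow_le hp hy, Real.rpow_one]
    linarith [norm_nonneg y]
  refine ⟨⌈L⌉₊, ?_, ?_⟩
  · have := (Real.logb_le_iff_le_rpow hp hy).1 (Nat.le_ceil L)
    rw [Real.rpow_natCast] at this
    linarith [prime_pos (p := p)]
  · have hk : (⌈L⌉₊ : ℝ) ≤ 2 * L := by linarith [Nat.ceil_lt_add_one (zero_le_one.trans hL₁)]
    calc ⌈L⌉₊ * d ≤ ⌈L⌉₊ * (C / L) := by gcongr
      _ ≤ 2 * L * (C / L) := by gcongr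
      _ = 2 * C := by field_simp

/-- `q₀` is the limit of the exponent `q` at infinity, approached so fast that powers `t ^ q(y)` and
`t ^ q₀` of numbers `t ≤ 1` are comparable with constant `K`, up to the integrable error
`decayFun`. -/
structure IsLimitExponent (q : Qpn p n → ℝ) (q₀ : ℝ) (K : ℝ≥0) : Prop where
  one_lt : 1 < q₀
  tendsto : Tendsto q (Bornology.cobounded (Qpn p n)) (𝓝 q₀)
  rpow_le : ∀ y, ∀ t ≤ (1 : ℝ≥0∞), t ^ q y ≤ K * t ^ q₀ + decayFun p n y
  rpow_limit_le : ∀ y, ∀ t ≤ (1 : ℝ≥0∞), t ^ q₀ ≤ K * t ^ q y + decayFun p n y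

lemma neBot_cobounded (hn : n ≠ 0) : (Bornology.cobounded (Qpn p n)).NeBot := by
  have : Nonempty (Fin n) := ⟨⟨0, Nat.pos_of_ne_zero hn⟩⟩
  exact NormedSpace.cobounded_neBot ℚ_[p] (Qpn p n)

lemma IsLogHolder.exists_abs_sub_le (hn : n ≠ 0) (hq : IsLogHolder q) :
    ∃ q₀ C : ℝ, 1 < q₀ ∧ 0 ≤ C ∧ ∀ y, |q y - q₀| ≤ C / Real.logb p (p + ‖y‖) := by
  have := neBot_cobounded (p := p) hn
  obtain ⟨C, hC, hinf⟩ := hq.infty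
  obtain ⟨q₀, hmem, hq₀⟩ := isCompact_Icc (a := essInf q (haar p n)) (b := essSup q (haar p n))
    (f := map q (Bornology.cobounded (Qpn p n))) (tendsto_principal.2 (Eventually.of_forall
      fun x => ⟨hq.isExponent.essInf_le x, hq.isExponent.le_essSup x⟩))
  refine ⟨q₀, C, hq.isExponent.one_lt.trans_le hmem.1, hC.le, fun y => ?_⟩
  have hclosed : IsClosed {s : ℝ | |q y - s| ≤ C / Real.logb p (p + ‖y‖)} :=
    isClosed_le (by fun_prop) continuous_const
  refine isClosed_iff_clusterPt.1 hclosed q₀ (hq₀.mono (tendsto_principal.2 ?_))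
  filter_upwards [tendsto_norm_cobounded_atTop.eventually_ge_atTop ‖y‖] with x hx
  simpa only [min_eq_left hx] using hinf y x

lemma tendsto_div_logb_cobounded (C : ℝ) :
    Tendsto (fun y : Qpn p n => C / Real.logb p (p + ‖y‖)) (Bornology.cobounded _) (𝓝 0) :=
  ((Real.tendsto_logb_atTop one_lt_prime).comp
    (tendsto_atTop_add_const_left _ _ tendsto_norm_cobounded_atTop)).const_div_atTop C

lemma IsLogHolder.exists_isLimitExponent (hn : n ≠ 0) (hq : IsLogHolder q) :
    ∃ q₀ K, IsLimitExponent q q₀ K := by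
  obtain ⟨q₀, C, hq₀, hC, hbound⟩ := hq.exists_abs_sub_le hn
  have hK : (((p : ℝ≥0) ^ (2 * C * (n + 1)) : ℝ≥0) : ℝ≥0∞) = (p : ℝ≥0∞) ^ (2 * C * (n + 1)) := by
    rw [ENNReal.coe_rpow_of_nonneg _ (by positivity), ENNReal.coe_natCast]
  refine ⟨q₀, (p : ℝ≥0) ^ (2 * C * (n + 1)), hq₀, ?_, fun y t ht => ?_, fun y t ht => ?_⟩
  · exact tendsto_iff_norm_sub_tendsto_zero.2
      (squeeze_zero (fun _ => norm_nonneg _) hbound (tendsto_div_logb_cobounded C))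
  · obtain ⟨k, hk, hkd⟩ := exists_norm_le_pow_mul_le hC (hbound y)
    rw [hK]
    exact rpow_le_rpow_add_decayFun hk ht (hq.isExponent.one_lt_apply y).le hkd
  · obtain ⟨k, hk, hkd⟩ := exists_norm_le_pow_mul_le hC (hbound y)
    rw [hK]
    exact rpow_le_rpow_add_decayFun hk ht hq₀.le (by rwa [abs_sub_comm])

lemma IsLimitExponent.one_div_eq {r : Qpn p n → ℝ} {r₀ q₀ σ : ℝ} {K L : ℝ≥0} (hn : n ≠ 0)
    (hr : IsLimitExponent r r₀ K) (hq : IsLimitExponent q q₀ L)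
    (hrel : ∀ x, 1 / q x = 1 / r x - σ) : 1 / q₀ = 1 / r₀ - σ := by
  have := neBot_cobounded (p := p) hn
  simp only [one_div] at hrel ⊢
  have hq' := hq.tendsto.inv₀ (zero_lt_one.trans hq.one_lt).ne'
  have hr' := (hr.tendsto.inv₀ (zero_lt_one.trans hr.one_lt).ne').sub_const σ
  simp only [hrel] at hq'
  exact tendsto_nhds_unique hq' hr'

end Exponents

section FractionalMaximal

variable {p : ℕ} [Fact p.Prime] {n : ℕ} {r q : Qpn p n → ℝ} {F : Qpn p n → ℝ≥0∞} {σ : ℝ}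

-- Hedberg's trick: the bound `K / |B|` controls large balls, the bound `X` small ones.
lemma fracMax_rpow_le {x : Qpn p n} {s t : ℝ} {K X : ℝ≥0∞} (hs : 0 < s) (ht : 0 < t) (hσ : 0 ≤ σ)
    (hrel : 1 / t = 1 / s - σ) (hK : ∀ γ, ballAvg γ F x ^ s ≤ K / haar p n (pball γ x))
    (hX : ∀ γ, ballAvg γ F x ^ s ≤ X) : fracMax σ F x ^ t ≤ K ^ (σ * t) * X := by
  rw [← ENNReal.le_rpow_inv_iff ht]
  refine iSup_le fun γ => ?_
  rw [ENNReal.le_rpow_inv_iff ht]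
  refine (rpow_mul_rpow_le_of_rpow_le_div (haar_pball_ne_zero γ x) (haar_pball_ne_top γ x)
    hs ht hσ hrel (hK γ)).trans ?_
  gcongr
  exact hX γ

lemma IsExponent.rpow_div_essInf_rpow (hr : IsExponent r) (F : Qpn p n → ℝ≥0∞) (y : Qpn p n) :
    (F y ^ (r y / essInf r (haar p n))) ^ essInf r (haar p n) = F y ^ r y := by
  rw [← ENNReal.rpow_mul, div_mul_cancel₀ _ (zero_lt_one.trans hr.one_lt).ne']

lemma ballAvg_rpow_ballInf_le (hr : IsExponent r) (hF : Measurable F)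
    (hF₁ : ∀ y, F y = 0 ∨ 1 ≤ F y) (γ : ℤ) (x : Qpn p n) :
    ballAvg γ F x ^ ballInf r γ x ≤
      ballAvg γ (fun y => F y ^ (r y / essInf r (haar p n))) x ^ essInf r (haar p n) := by
  set m := essInf r (haar p n)
  have hm : 0 < m := zero_lt_one.trans hr.one_lt
  have hmρ : m ≤ ballInf r γ x := hr.essInf_le_ballInf γ x
  calc ballAvg γ F x ^ ballInf r γ x = (ballAvg γ F x ^ (ballInf r γ x / m)) ^ m := by
        rw [← ENNReal.rpow_mul, div_mul_cancel₀ _ hm.ne']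
    _ ≤ ballAvg γ (fun y => F y ^ (ballInf r γ x / m)) x ^ m := by
        gcongr
        exact laverage_rpow_le_laverage_rpow hF.aemeasurable ((one_le_div hm).2 hmρ)
    _ ≤ ballAvg γ (fun y => F y ^ (r y / m)) x ^ m := by
        refine ENNReal.rpow_le_rpow (laverage_mono_ae ?_) hm.le
        filter_upwards [hr.ae_restrict_mem_Icc γ x] with y hy
        rcases hF₁ y with h | h
        · rw [h, ENNReal.zero_rpow_of_pos (div_pos (hm.trans_le hmρ) hm)]
          exact zero_le
        · exact ENNReal.rpow_le_rpow_of_exponent_le h (by gcongr; exact hy.1)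

lemma ballAvg_rpow_le_lintegral_div (hF : Measurable F) {P : ℝ} (hP : 1 ≤ P) (γ : ℤ)
    (x : Qpn p n) :
    ballAvg γ F x ^ P ≤ (∫⁻ y, F y ^ P ∂(haar p n)) / haar p n (pball γ x) :=
  (laverage_rpow_le_laverage_rpow hF.aemeasurable hP).trans (ballAvg_le_lintegral_div γ _ x)

lemma exists_ae_ballAvg_rpow_le_of_one_le (hr : IsLogHolder r) :
    ∃ K : ℝ≥0, 1 ≤ K ∧ ∀ F : Qpn p n → ℝ≥0∞, Measurable F → (∀ y, F y = 0 ∨ 1 ≤ F y) →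
      ∫⁻ y, F y ^ r y ∂(haar p n) ≤ 1 → ∀ᵐ x ∂(haar p n), ∀ γ,
        ballAvg γ F x ^ r x ≤ K / haar p n (pball γ x) ∧
        ballAvg γ F x ^ r x ≤ K *
          fracMax 0 (fun y => F y ^ (r y / essInf r (haar p n))) x ^ essInf r (haar p n) := by
  obtain ⟨K, hK, hloc⟩ := hr.exists_inv_haar_pball_rpow_le
  have hre := hr.isExponent
  refine ⟨K, hK, fun F hF hF₁ hFr => ?_⟩
  set m := essInf r (haar p n)
  set G : Qpn p n → ℝ≥0∞ := fun y => F y ^ (r y / m)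
  have hm : 0 ≤ m := zero_le_one.trans hre.one_lt.le
  filter_upwards [hloc, hre.ae_forall_mem_Icc] with x hx hmem γ
  have hinv : ballAvg γ G x ^ m ≤ (haar p n (pball γ x))⁻¹ := by
    refine (ballAvg_rpow_le_lintegral_div (hF.pow (hre.measurable.div_const m)) hre.one_lt.le
      γ x).trans ?_
    rw [← one_div]
    gcongr
    simpa only [G, m, hre.rpow_div_essInf_rpow] using hFr
  have hmain : ballAvg γ F x ^ r x ≤ K * ballAvg γ G x ^ m :=
    rpow_le_mul_of_rpow_le (hre.one_lt.le.trans (hre.essInf_le_ballInf γ x)) (hmem γ).1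
      (by exact_mod_cast hK) (ballAvg_rpow_ballInf_le hre hF hF₁ γ x)
      ((ENNReal.rpow_le_rpow hinv (sub_nonneg.2 (hmem γ).1)).trans (hx γ))
  refine ⟨hmain.trans (mul_le_mul_right hinv _), hmain.trans ?_⟩
  gcongr
  exact ballAvg_le_fracMax_zero γ G x

lemma exists_lintegral_fracMax_rpow_le_of_one_le (hr : IsLogHolder r) (hq : IsExponent q)
    (hσ : 0 ≤ σ) (hrel : ∀ x, 1 / q x = 1 / r x - σ) :
    ∃ C : ℝ≥0, ∀ F : Qpn p n → ℝ≥0∞, Measurable F → (∀ y, F y = 0 ∨ 1 ≤ F y) →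
      ∫⁻ y, F y ^ r y ∂(haar p n) ≤ 1 → ∫⁻ x, fracMax σ F x ^ q x ∂(haar p n) ≤ C := by
  have hre := hr.isExponent
  obtain ⟨K, hK, hKF⟩ := exists_ae_ballAvg_rpow_le_of_one_le hr
  obtain ⟨C, hC⟩ := exists_lintegral_fracMax_zero_rpow_le (p := p) (n := n) hre.one_lt
  set m := essInf r (haar p n)
  set D : ℝ≥0∞ := (K : ℝ≥0∞) ^ (σ * essSup q (haar p n)) * K
  have hD : D ≠ ∞ := ENNReal.mul_ne_top (ENNReal.rpow_ne_top_of_nonneg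
    (mul_nonneg hσ (zero_le_one.trans hq.one_le_essSup)) ENNReal.coe_ne_top) ENNReal.coe_ne_top
  refine ⟨(D * C).toNNReal, fun F hF hF₁ hFr => ?_⟩
  set G : Qpn p n → ℝ≥0∞ := fun y => F y ^ (r y / m)
  have hpt : ∀ᵐ x ∂(haar p n), fracMax σ F x ^ q x ≤ D * fracMax 0 G x ^ m := by
    filter_upwards [hKF F hF hF₁ hFr] with x hx
    calc fracMax σ F x ^ q x ≤ (K : ℝ≥0∞) ^ (σ * q x) * (K * fracMax 0 G x ^ m) :=
          fracMax_rpow_le (hre.pos x) (hq.pos x) hσ (hrel x) (fun γ => (hx γ).1)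
            fun γ => (hx γ).2
      _ ≤ (K : ℝ≥0∞) ^ (σ * essSup q (haar p n)) * (K * fracMax 0 G x ^ m) := by
          gcongr
          exacts [by exact_mod_cast hK, hq.le_essSup x]
      _ = D * fracMax 0 G x ^ m := (mul_assoc _ _ _).symm
  calc ∫⁻ x, fracMax σ F x ^ q x ∂(haar p n)
      ≤ ∫⁻ x, D * fracMax 0 G x ^ m ∂(haar p n) := lintegral_mono_ae hpt
    _ = D * ∫⁻ x, fracMax 0 G x ^ m ∂(haar p n) := lintegral_const_mul' _ _ hD
    _ ≤ D * (C * ∫⁻ y, G y ^ m ∂(haar p n)) := by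
        gcongr
        exact hC G (hF.pow (hre.measurable.div_const m))
    _ ≤ D * (C * 1) := by
        gcongr
        simpa only [G, m, hre.rpow_div_essInf_rpow] using hFr
    _ = ((D * C).toNNReal : ℝ≥0∞) := by
        rw [mul_one, ENNReal.coe_toNNReal (ENNReal.mul_ne_top hD ENNReal.coe_ne_top)]

lemma IsLimitExponent.lintegral_rpow_le {q₀ : ℝ} {K : ℝ≥0} (hq : IsLimitExponent q q₀ K)
    (hF₁ : ∀ y, F y ≤ 1) : ∫⁻ y, F y ^ q y ∂(haar p n) ≤
      K * ∫⁻ y, F y ^ q₀ ∂(haar p n) + ∫⁻ y, decayFun p n y ∂(haar p n) := by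
  rw [← lintegral_const_mul' _ _ ENNReal.coe_ne_top, ← lintegral_add_right _ measurable_decayFun]
  exact lintegral_mono fun y => hq.rpow_le y (F y) (hF₁ y)

lemma IsLimitExponent.lintegral_rpow_limit_le {q₀ : ℝ} {K : ℝ≥0} (hq : IsLimitExponent q q₀ K)
    (hF₁ : ∀ y, F y ≤ 1) : ∫⁻ y, F y ^ q₀ ∂(haar p n) ≤
      K * ∫⁻ y, F y ^ q y ∂(haar p n) + ∫⁻ y, decayFun p n y ∂(haar p n) := by
  rw [← lintegral_const_mul' _ _ ENNReal.coe_ne_top, ← lintegral_add_right _ measurable_decayFun]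
  exact lintegral_mono fun y => hq.rpow_limit_le y (F y) (hF₁ y)

lemma fracMax_zero_le_one (hF₁ : ∀ y, F y ≤ 1) (x : Qpn p n) : fracMax 0 F x ≤ 1 := by
  rw [fracMax_zero]
  exact iSup_le fun γ => (laverage_mono_ae (ae_of_all _ hF₁)).trans_eq (ballAvg_const 1 γ x)

lemma fracMax_div_rpow_le (hF : Measurable F) {r₀ q₀ : ℝ} (hr₀ : 1 ≤ r₀) (hq₀ : 0 < q₀)
    (hσ : 0 ≤ σ) (hrel : 1 / q₀ = 1 / r₀ - σ) {K : ℝ≥0∞}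
    (hFK : ∫⁻ y, F y ^ r₀ ∂(haar p n) ≤ K) (x : Qpn p n) :
    (fracMax σ F x / K ^ σ) ^ q₀ ≤ fracMax 0 F x ^ r₀ := by
  rw [ENNReal.div_rpow_of_nonneg _ _ hq₀.le, ← ENNReal.rpow_mul]
  refine ENNReal.div_le_of_le_mul' ?_
  refine fracMax_rpow_le (zero_lt_one.trans_le hr₀) hq₀ hσ hrel (fun γ => ?_) fun γ => ?_
  · exact (ballAvg_rpow_le_lintegral_div hF hr₀ γ x).trans (ENNReal.div_le_div_right hFK _)
  · exact ENNReal.rpow_le_rpow (ballAvg_le_fracMax_zero γ F x) (zero_le_one.trans hr₀)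

lemma IsExponent.lintegral_rpow_le_mul (hq : IsExponent q) {L : ℝ≥0∞} (hL₁ : 1 ≤ L) (hL : L ≠ ∞)
    (F : Qpn p n → ℝ≥0∞) : ∫⁻ x, F x ^ q x ∂(haar p n) ≤
      L ^ essSup q (haar p n) * ∫⁻ x, (F x / L) ^ q x ∂(haar p n) := by
  rw [← lintegral_const_mul' _ _
    (ENNReal.rpow_ne_top_of_nonneg (zero_le_one.trans hq.one_le_essSup) hL)]
  refine lintegral_mono fun x => ?_
  calc F x ^ q x = L ^ q x * (F x / L) ^ q x := by
        rw [← ENNReal.mul_rpow_of_nonneg _ _ (hq.pos x).le,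
          ENNReal.mul_div_cancel (zero_lt_one.trans_le hL₁).ne' hL]
    _ ≤ L ^ essSup q (haar p n) * (F x / L) ^ q x := by
        gcongr
        exact hq.le_essSup x

lemma exists_lintegral_fracMax_rpow_le_of_le_one (hn : n ≠ 0) (hr : IsLogHolder r)
    (hq : IsLogHolder q) (hσ : 0 ≤ σ) (hrel : ∀ x, 1 / q x = 1 / r x - σ) :
    ∃ C : ℝ≥0, ∀ F : Qpn p n → ℝ≥0∞, Measurable F → (∀ y, F y ≤ 1) →
      ∫⁻ y, F y ^ r y ∂(haar p n) ≤ 1 → ∫⁻ x, fracMax σ F x ^ q x ∂(haar p n) ≤ C := by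
  obtain ⟨r₀, K, hr₀⟩ := hr.exists_isLimitExponent hn
  obtain ⟨q₀, K', hq₀⟩ := hq.exists_isLimitExponent hn
  obtain ⟨C, hC⟩ := exists_lintegral_fracMax_zero_rpow_le (p := p) (n := n) hr₀.one_lt
  have hq₀_pos : 0 < q₀ := zero_lt_one.trans hq₀.one_lt
  obtain ⟨H, hH, -⟩ := ENNReal.lt_iff_exists_coe.1 (lintegral_decayFun_lt_top (p := p) (n := n))
  set L : ℝ≥0 := K + H + 1
  have hL₁ : (1 : ℝ≥0∞) ≤ L := by exact_mod_cast (le_add_self : (1 : ℝ≥0) ≤ K + H + 1)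
  set Q := essSup q (haar p n)
  have hQ : 0 ≤ Q := zero_le_one.trans hq.isExponent.one_le_essSup
  refine ⟨(L ^ σ) ^ Q * (K' * (C * L) + H), fun F hF hF₁ hFr => ?_⟩
  have hFL : ∫⁻ y, F y ^ r₀ ∂(haar p n) ≤ L := by
    calc ∫⁻ y, F y ^ r₀ ∂(haar p n) ≤ K * 1 + H :=
          (hr₀.lintegral_rpow_limit_le hF₁).trans (by rw [hH]; gcongr)
      _ ≤ L := by
          rw [mul_one]
          exact_mod_cast (le_self_add : K + H ≤ K + H + 1)
  have hT := fracMax_div_rpow_le hF hr₀.one_lt.le hq₀_pos hσ (hr₀.one_div_eq hn hq₀ hrel) hFL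
  have hT₁ : ∀ x, fracMax σ F x / (L : ℝ≥0∞) ^ σ ≤ 1 := fun x =>
    (ENNReal.rpow_le_rpow_iff hq₀_pos).1 <| (hT x).trans <| by
      simpa using ENNReal.rpow_le_one (fracMax_zero_le_one hF₁ x)
        (zero_le_one.trans hr₀.one_lt.le)
  calc ∫⁻ x, fracMax σ F x ^ q x ∂(haar p n)
      ≤ ((L : ℝ≥0∞) ^ σ) ^ Q * ∫⁻ x, (fracMax σ F x / (L : ℝ≥0∞) ^ σ) ^ q x ∂(haar p n) :=
        hq.isExponent.lintegral_rpow_le_mul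
          ((ENNReal.one_rpow σ).symm.trans_le (ENNReal.rpow_le_rpow hL₁ hσ))
          (ENNReal.rpow_ne_top_of_nonneg hσ ENNReal.coe_ne_top) _
    _ ≤ ((L : ℝ≥0∞) ^ σ) ^ Q * (K' * ∫⁻ x, fracMax 0 F x ^ r₀ ∂(haar p n) + H) := by
        gcongr
        exact (hq₀.lintegral_rpow_le hT₁).trans (by rw [hH]; gcongr; exact hT _)
    _ ≤ ((L : ℝ≥0∞) ^ σ) ^ Q * (K' * (C * L) + H) := by
        gcongr
        exact (hC F hF).trans (by gcongr)
    _ = ((L ^ σ) ^ Q * (K' * (C * L) + H) : ℝ≥0) := by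
        rw [← ENNReal.coe_rpow_of_nonneg _ hσ, ← ENNReal.coe_rpow_of_nonneg _ hQ]
        push_cast
        rfl

lemma IsExponent.add_rpow_le (hq : IsExponent q) (a b : ℝ≥0∞) (x : Qpn p n) :
    (a + b) ^ q x ≤ 2 ^ (essSup q (haar p n) - 1) * (a ^ q x + b ^ q x) :=
  (ENNReal.rpow_add_le_mul_rpow_add_rpow a b (hq.one_lt_apply x).le).trans <| by
    gcongr
    exacts [one_le_two, hq.le_essSup x]

theorem exists_lintegral_fracMax_rpow_le (hn : n ≠ 0) (hr : IsLogHolder r) (hq : IsLogHolder q)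
    (hσ : 0 ≤ σ) (hrel : ∀ x, 1 / q x = 1 / r x - σ) :
    ∃ C : ℝ≥0, ∀ F : Qpn p n → ℝ≥0∞, Measurable F →
      ∫⁻ y, F y ^ r y ∂(haar p n) ≤ 1 → ∫⁻ x, fracMax σ F x ^ q x ∂(haar p n) ≤ C := by
  have hqe := hq.isExponent
  obtain ⟨C₁, hC₁⟩ := exists_lintegral_fracMax_rpow_le_of_one_le hr hqe hσ hrel
  obtain ⟨C₂, hC₂⟩ := exists_lintegral_fracMax_rpow_le_of_le_one hn hr hq hσ hrel
  set Q := essSup q (haar p n)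
  have hQ : 0 ≤ Q - 1 := sub_nonneg.2 hqe.one_le_essSup
  refine ⟨2 ^ (Q - 1) * (C₁ + C₂), fun F hF hFr => ?_⟩
  set E := {y | 1 ≤ F y}
  have hE : MeasurableSet E := measurableSet_le measurable_const hF
  have hle : ∀ A : Set (Qpn p n), ∫⁻ y, A.indicator F y ^ r y ∂(haar p n) ≤ 1 := fun A =>
    (lintegral_mono fun y => ENNReal.rpow_le_rpow (Set.indicator_le_self A F y)
      (hr.isExponent.pos y).le).trans hFr
  have hlarge := hC₁ (E.indicator F) (hF.indicator hE) (fun y => by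
    by_cases h : y ∈ E
    · exact Or.inr (by rwa [Set.indicator_of_mem h])
    · exact Or.inl (Set.indicator_of_notMem h F)) (hle E)
  have hsmall := hC₂ (Eᶜ.indicator F) (hF.indicator hE.compl)
    (Set.indicator_le fun y hy => (le_of_not_ge (show ¬1 ≤ F y from hy))) (hle Eᶜ)
  have hsum : (fun y => E.indicator F y + Eᶜ.indicator F y) = F := Set.indicator_self_add_compl E F
  calc ∫⁻ x, fracMax σ F x ^ q x ∂(haar p n)
      ≤ ∫⁻ x, 2 ^ (Q - 1) * (fracMax σ (E.indicator F) x ^ q x +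
          fracMax σ (Eᶜ.indicator F) x ^ q x) ∂(haar p n) := by
        refine lintegral_mono fun x => (ENNReal.rpow_le_rpow ?_ (hqe.pos x).le).trans
          (hqe.add_rpow_le _ _ x)
        simpa only [hsum] using fracMax_add_le (hF.indicator hE) (Eᶜ.indicator F) σ x
    _ = 2 ^ (Q - 1) * (∫⁻ x, fracMax σ (E.indicator F) x ^ q x ∂(haar p n) +
          ∫⁻ x, fracMax σ (Eᶜ.indicator F) x ^ q x ∂(haar p n)) := by
        rw [lintegral_const_mul' _ _ (ENNReal.rpow_ne_top_of_nonneg hQ ENNReal.ofNat_ne_top),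
          lintegral_add_left ((measurable_fracMax σ _).pow hqe.measurable)]
    _ ≤ 2 ^ (Q - 1) * (C₁ + C₂) := by gcongr
    _ = (2 ^ (Q - 1) * (C₁ + C₂) : ℝ≥0) := by
        push_cast [ENNReal.coe_rpow_of_nonneg _ hQ]
        rfl

end FractionalMaximal

section LuxemburgNorm

variable {p : ℕ} [Fact p.Prime] {n : ℕ} {E E' : Type*} [ENorm E] [ENorm E'] {r q : Qpn p n → ℝ}
  {f : Qpn p n → E} {g : Qpn p n → E'} {A : Set (Qpn p n)} {σ : ℝ}

lemma varNorm_le {η : ℝ≥0} (hη : 0 < η) (h : modular q f η ≤ 1) : varNorm q f ≤ η :=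
  iInf₂_le η ⟨hη, h⟩

lemma varNorm_le_mul_varNorm {c : ℝ≥0∞} (hc₀ : c ≠ 0) (hc : c ≠ ∞)
    (h : ∀ η : ℝ≥0, 0 < η → modular r g η ≤ 1 →
      ∫⁻ x, (‖f x‖ₑ / (c * η)) ^ q x ∂(haar p n) ≤ 1) :
    varNorm q f ≤ c * varNorm r g := by
  lift c to ℝ≥0 using hc
  simp only [varNorm, ENNReal.mul_iInf_of_ne hc₀ ENNReal.coe_ne_top]
  refine le_iInf₂ fun η hη => ?_
  rw [← ENNReal.coe_mul]
  refine varNorm_le (mul_pos (pos_iff_ne_zero.2 (by simpa using hc₀)) hη.1) ?_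
  simpa only [modular, ENNReal.coe_mul] using h η hη.1 hη.2

lemma varNorm_eq_zero_of_ae (hq : IsExponent q) (hf : ∀ᵐ x ∂(haar p n), ‖f x‖ₑ = 0) :
    varNorm q f = 0 := by
  refine nonpos_iff_eq_zero.1 <| ENNReal.le_of_forall_pos_le_add fun η hη _ => ?_
  rw [zero_add]
  refine varNorm_le hη (le_of_eq_of_le ?_ zero_le_one)
  refine (lintegral_congr_ae ?_).trans lintegral_zero
  filter_upwards [hf] with x hx
  rw [hx, ENNReal.zero_div, ENNReal.zero_rpow_of_pos (hq.pos x)]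

lemma varNorm_le_mul_of_ae_le (hq : IsExponent q) {c : ℝ≥0∞} (hc : c ≠ ∞)
    (h : ∀ᵐ x ∂(haar p n), ‖f x‖ₑ ≤ c * ‖g x‖ₑ) : varNorm q f ≤ c * varNorm q g := by
  rcases eq_or_ne c 0 with rfl | hc₀
  · simp only [zero_mul, nonpos_iff_eq_zero] at h
    exact (varNorm_eq_zero_of_ae hq h).trans_le zero_le
  refine varNorm_le_mul_varNorm hc₀ hc fun η _ hg => (lintegral_mono_ae ?_).trans hg
  filter_upwards [h] with x hx
  exact ENNReal.rpow_le_rpow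
    ((ENNReal.div_le_div_right hx _).trans_eq (ENNReal.mul_div_mul_left _ _ hc₀ hc)) (hq.pos x).le

lemma IsExponent.lintegral_div_rpow_le_one (hq : IsExponent q) {F : Qpn p n → ℝ≥0∞} {C : ℝ≥0∞}
    (hC₁ : 1 ≤ C) (h : ∫⁻ x, F x ^ q x ∂(haar p n) ≤ C) :
    ∫⁻ x, (F x / C) ^ q x ∂(haar p n) ≤ 1 :=
  have hC₀ : C ≠ 0 := (zero_lt_one.trans_le hC₁).ne'
  calc ∫⁻ x, (F x / C) ^ q x ∂(haar p n) ≤ ∫⁻ x, F x ^ q x * C⁻¹ ∂(haar p n) :=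
        lintegral_mono fun x => div_rpow_le_rpow_div hC₁ (hq.one_lt_apply x).le
    _ = (∫⁻ x, F x ^ q x ∂(haar p n)) / C := lintegral_mul_const' _ _ (ENNReal.inv_ne_top.2 hC₀)
    _ ≤ 1 := ENNReal.div_le_of_le_mul (by rwa [one_mul])

lemma memVarLp_iff [MeasurableSpace E] (hq : IsExponent q) :
    MemVarLp q f ↔ AEMeasurable f (haar p n) ∧ varNorm q f < ∞ := by
  refine and_congr_right fun _ => ⟨fun ⟨η, hη, hf⟩ => ?_, fun hf => ?_⟩
  · lift modular q f η to ℝ≥0 using hf.ne with M hM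
    have hle := hq.lintegral_div_rpow_le_one (F := fun x => ‖f x‖ₑ / η) (C := (M + 1 : ℝ≥0))
      (by exact_mod_cast (le_add_self : 1 ≤ M + 1))
      (hM.symm.trans_le (by exact_mod_cast (le_self_add : M ≤ M + 1)))
    refine (varNorm_le (η := η * (M + 1)) (by positivity) ?_).trans_lt ENNReal.coe_lt_top
    refine (lintegral_congr fun x => ?_).trans_le hle
    rw [ENNReal.coe_mul, div_coe_mul_coe]
  · obtain ⟨η, hη⟩ := iInf_lt_iff.1 hf
    obtain ⟨⟨hη₀, hη₁⟩, -⟩ := iInf_lt_iff.1 hη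
    exact ⟨η, hη₀, hη₁.trans_lt ENNReal.one_lt_top⟩

lemma lintegral_indicator_rpow (hq : IsExponent q) (hA : MeasurableSet A) (c : ℝ≥0∞) :
    ∫⁻ x, A.indicator (fun _ => c) x ^ q x ∂(haar p n) = ∫⁻ x in A, c ^ q x ∂(haar p n) := by
  rw [← lintegral_indicator hA]
  refine lintegral_congr fun x => ?_
  by_cases h : x ∈ A
  · simp only [h, Set.indicator_of_mem]
  · simp only [h, not_false_eq_true, Set.indicator_of_notMem, ENNReal.zero_rpow_of_pos (hq.pos x)]

lemma enorm_indicator_one_div (A : Set (Qpn p n)) (c : ℝ≥0∞) (x : Qpn p n) :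
    ‖A.indicator (fun _ => (1 : ℝ)) x‖ₑ / c = A.indicator (fun _ => c⁻¹) x := by
  by_cases h : x ∈ A <;> simp [h]

lemma modular_indicator_one (hq : IsExponent q) (hA : MeasurableSet A) (η : ℝ≥0) :
    modular q (A.indicator fun _ => (1 : ℝ)) η = ∫⁻ x in A, (η : ℝ≥0∞)⁻¹ ^ q x ∂(haar p n) := by
  simp only [modular, enorm_indicator_one_div, lintegral_indicator_rpow hq hA]

lemma memVarLp_indicator_one (hq : IsExponent q) (hA : MeasurableSet A) (hμA : haar p n A ≠ ∞) :
    MemVarLp q (A.indicator fun _ => (1 : ℝ)) := by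
  refine ⟨(measurable_const.indicator hA).aemeasurable, 1, zero_lt_one, ?_⟩
  simpa [modular_indicator_one hq hA] using hμA.lt_top

lemma varNorm_indicator_one_ne_top (hq : IsExponent q) (hA : MeasurableSet A)
    (hμA : haar p n A ≠ ∞) : varNorm q (A.indicator fun _ => (1 : ℝ)) ≠ ∞ :=
  ((memVarLp_iff hq).1 (memVarLp_indicator_one hq hA hμA)).2.ne

lemma min_one_haar_le_varNorm_indicator_one (hq : IsExponent q) (hA : MeasurableSet A) :
    min 1 (haar p n A) ≤ varNorm q (A.indicator fun _ => (1 : ℝ)) := by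
  refine le_iInf₂ fun η ⟨hη₀, hη⟩ => min_le_iff.2 <| (le_total 1 (η : ℝ≥0∞)).imp_right fun h => ?_
  have hmean : (η : ℝ≥0∞)⁻¹ * haar p n A ≤ 1 := by
    rw [← setLIntegral_const]
    refine le_trans (lintegral_mono fun x => ?_) (modular_indicator_one hq hA η ▸ hη)
    exact ENNReal.le_rpow_self_of_one_le (ENNReal.one_le_inv.2 h) (hq.one_lt_apply x).le
  rwa [← ENNReal.div_eq_inv_mul, ENNReal.div_le_iff (by simpa using hη₀.ne') ENNReal.coe_ne_top,
    one_mul] at hmean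

lemma varNorm_indicator_one_ne_zero (hq : IsExponent q) (hA : MeasurableSet A)
    (hμA : haar p n A ≠ 0) : varNorm q (A.indicator fun _ => (1 : ℝ)) ≠ 0 :=
  ((lt_min zero_lt_one (pos_iff_ne_zero.2 hμA)).trans_le
    (min_one_haar_le_varNorm_indicator_one hq hA)).ne'

-- Young's inequality with exponents `q / r` and `1 / (σ r)`, integrated over `A`.
theorem varNorm_indicator_one_le (hr : IsExponent r) (hq : IsExponent q) (hσ : 0 ≤ σ)
    (hrel : ∀ x, 1 / q x = 1 / r x - σ) (hA : MeasurableSet A) (hA₀ : haar p n A ≠ 0)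
    (hμA : haar p n A ≠ ∞) :
    varNorm r (A.indicator fun _ => (1 : ℝ)) ≤
      2 * haar p n A ^ σ * varNorm q (A.indicator fun _ => (1 : ℝ)) := by
  set V := haar p n A
  have hV₀ : V ^ σ ≠ 0 := (ENNReal.rpow_pos (pos_iff_ne_zero.2 hA₀) hμA).ne'
  have hV : V ^ σ ≠ ∞ := ENNReal.rpow_ne_top_of_nonneg hσ hμA
  refine varNorm_le_mul_varNorm (mul_ne_zero two_ne_zero hV₀)
    (ENNReal.mul_ne_top ENNReal.ofNat_ne_top hV) fun η _ hmod => ?_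
  rw [modular_indicator_one hq hA] at hmod
  have hYoung : ∫⁻ x, A.indicator (fun _ => (η : ℝ≥0∞)⁻¹ * V⁻¹ ^ σ) x ^ r x ∂(haar p n) ≤ 2 :=
    calc ∫⁻ x, A.indicator (fun _ => (η : ℝ≥0∞)⁻¹ * V⁻¹ ^ σ) x ^ r x ∂(haar p n)
        = ∫⁻ x in A, ((η : ℝ≥0∞)⁻¹ * V⁻¹ ^ σ) ^ r x ∂(haar p n) := lintegral_indicator_rpow hr hA _
      _ ≤ ∫⁻ x in A, ((η : ℝ≥0∞)⁻¹ ^ q x + V⁻¹) ∂(haar p n) :=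
          lintegral_mono fun x => mul_rpow_rpow_le_add (hr.pos x) (hq.pos x) hσ (hrel x)
      _ = ∫⁻ x in A, (η : ℝ≥0∞)⁻¹ ^ q x ∂(haar p n) + 1 := by
          rw [lintegral_add_right _ measurable_const, setLIntegral_const,
            ENNReal.inv_mul_cancel hA₀ hμA]
      _ ≤ 2 := (add_le_add_left hmod 1).trans_eq one_add_one_eq_two
  refine (lintegral_congr fun x => ?_).trans_le
    (hr.lintegral_div_rpow_le_one one_le_two hYoung)
  by_cases hx : x ∈ A
  · simp only [hx, Set.indicator_of_mem, enorm_one, one_div]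
    rw [mul_assoc, ENNReal.mul_inv (Or.inl two_ne_zero) (Or.inl ENNReal.ofNat_ne_top),
      ENNReal.mul_inv (Or.inl hV₀) (Or.inl hV), ENNReal.inv_rpow, div_eq_mul_inv]
    ring_nf
  · simp [hx]

lemma fracMax_div {F : Qpn p n → ℝ≥0∞} (hF : AEMeasurable F (haar p n)) {c : ℝ≥0∞} (hc : c ≠ 0)
    (x : Qpn p n) : fracMax σ F x / c = fracMax σ (fun y => hF.mk F y / c) x := by
  simp only [div_eq_mul_inv, mul_comm _ c⁻¹, fracMax_const_mul (ENNReal.inv_ne_top.2 hc),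
    fracMax_congr_ae hF.ae_eq_mk σ]

theorem exists_varNorm_fracMax_le (hn : n ≠ 0) (hr : IsLogHolder r) (hq : IsLogHolder q)
    (hσ : 0 ≤ σ) (hrel : ∀ x, 1 / q x = 1 / r x - σ) :
    ∃ C : ℝ≥0, ∀ F : Qpn p n → ℝ≥0∞, AEMeasurable F (haar p n) →
      varNorm q (fracMax σ F) ≤ C * varNorm r F := by
  obtain ⟨C, hC⟩ := exists_lintegral_fracMax_rpow_le hn hr hq hσ hrel
  refine ⟨C + 1, fun F hF => ?_⟩
  refine varNorm_le_mul_varNorm (by simp) ENNReal.coe_ne_top fun η hη hmod => ?_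
  have hη₀ : (η : ℝ≥0∞) ≠ 0 := by simpa using hη.ne'
  have hle := hC _ (hF.measurable_mk.div_const (η : ℝ≥0∞)) <| (lintegral_congr_ae <| by
    filter_upwards [hF.ae_eq_mk] with x hx
    rw [← hx, enorm_eq_self]).trans_le hmod
  have hdiv := hq.isExponent.lintegral_div_rpow_le_one (C := (C + 1 : ℝ≥0))
    (by exact_mod_cast (le_add_self : 1 ≤ C + 1))
    (hle.trans (by exact_mod_cast (le_self_add : C ≤ C + 1)))
  refine (lintegral_congr fun x => ?_).trans_le hdiv
  rw [← fracMax_div hF hη₀, enorm_eq_self, mul_comm, div_coe_mul_coe]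

end LuxemburgNorm

section Commutator

variable {p : ℕ} [Fact p.Prime] {n : ℕ} {α β σ : ℝ} {b b' f f' : Qpn p n → ℝ}
  {r q : Qpn p n → ℝ} {γ : ℤ} {x y : Qpn p n}

lemma rpow_haar_pball_ne_zero (s : ℝ) (γ : ℤ) (x : Qpn p n) : haar p n (pball γ x) ^ s ≠ 0 := by
  simp [ENNReal.rpow_eq_zero_iff, haar_pball_ne_zero, haar_pball_ne_top]

lemma rpow_haar_pball_ne_top (s : ℝ) (γ : ℤ) (x : Qpn p n) : haar p n (pball γ x) ^ s ≠ ∞ :=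
  ENNReal.rpow_ne_top_of_ne_zero (haar_pball_ne_zero γ x) (haar_pball_ne_top γ x)

lemma enorm_sub_le_lipNorm_mul (β : ℝ) (b : Qpn p n → ℝ) (x y : Qpn p n) :
    ‖b x - b y‖ₑ ≤ lipNorm β b * ‖x - y‖ₑ ^ β := by
  rcases eq_or_ne x y with rfl | h
  · simp
  have h₀ : ‖x - y‖ₑ ≠ 0 := by simpa [sub_eq_zero] using h
  rw [← ENNReal.div_le_iff (ENNReal.rpow_pos (pos_iff_ne_zero.2 h₀) enorm_ne_top).ne'
    (ENNReal.rpow_ne_top_of_ne_zero h₀ enorm_ne_top)]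
  exact le_iSup₂_of_le x y (le_iSup_of_le h le_rfl)

lemma enorm_sub_le_lipNorm_mul_rpow_haar_pball (hn : n ≠ 0) (hβ : 0 ≤ β) (b : Qpn p n → ℝ)
    (hy : y ∈ pball γ x) : ‖b x - b y‖ₑ ≤ lipNorm β b * haar p n (pball γ x) ^ (β / n) := by
  refine (enorm_sub_le_lipNorm_mul β b x y).trans ?_
  rw [haar_pball_rpow_div hn, ENNReal.rpow_mul]
  gcongr
  exact enorm_sub_le_of_mem_pball hy

lemma maxCommutator_eq_fracMax (α : ℝ) (b f : Qpn p n → ℝ) (x : Qpn p n) :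
    maxCommutator α b f x = fracMax (α / n) (fun y => ‖b x - b y‖ₑ * ‖f y‖ₑ) x := by
  simp only [maxCommutator, fracMax, ballAvg_eq_inv_mul]
  congr! 2 with γ
  rw [ENNReal.rpow_sub _ _ (haar_pball_ne_zero γ x) (haar_pball_ne_top γ x), ENNReal.rpow_one,
    ENNReal.inv_div (Or.inl (rpow_haar_pball_ne_top _ γ x))
      (Or.inl (rpow_haar_pball_ne_zero _ γ x)), div_eq_mul_inv, mul_assoc]

lemma maxCommutator_congr_ae (α : ℝ) (hb : b =ᵐ[haar p n] b') (hf : f =ᵐ[haar p n] f') :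
    maxCommutator α b f =ᵐ[haar p n] maxCommutator α b' f' := by
  filter_upwards [hb] with x hx
  rw [maxCommutator_eq_fracMax, maxCommutator_eq_fracMax, hx]
  refine congrFun (fracMax_congr_ae ?_ _) x
  filter_upwards [hb, hf] with y hby hfy
  rw [hby, hfy]

lemma measurable_maxCommutator (α : ℝ) (hb : Measurable b) (hf : Measurable f) :
    Measurable (maxCommutator α b f) := by
  simp only [funext (maxCommutator_eq_fracMax α b f), fracMax, haar_pball]
  refine Measurable.iSup fun γ => (measurable_ballAvg_of_uncurry γ ?_).const_mul _
  exact ((hb.comp measurable_fst).sub (hb.comp measurable_snd)).enorm.mul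
    (hf.comp measurable_snd).enorm

lemma maxCommutator_le_lipNorm_mul_fracMax (hn : n ≠ 0) (α : ℝ) (hβ : 0 ≤ β)
    (hb : lipNorm β b ≠ ∞) (f : Qpn p n → ℝ) (x : Qpn p n) :
    maxCommutator α b f x ≤ lipNorm β b * fracMax ((α + β) / n) (fun y => ‖f y‖ₑ) x := by
  rw [maxCommutator_eq_fracMax]
  refine iSup_le fun γ => ?_
  set V := haar p n (pball γ x)
  have havg : ballAvg γ (fun y => ‖b x - b y‖ₑ * ‖f y‖ₑ) x ≤
      lipNorm β b * V ^ (β / n) * ballAvg γ (fun y => ‖f y‖ₑ) x :=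
    ballAvg_le_mul_ballAvg (ENNReal.mul_ne_top hb (rpow_haar_pball_ne_top _ γ x)) fun y hy =>
      mul_le_mul_left (enorm_sub_le_lipNorm_mul_rpow_haar_pball hn hβ b hy) _
  calc V ^ (α / n) * ballAvg γ (fun y => ‖b x - b y‖ₑ * ‖f y‖ₑ) x
      ≤ V ^ (α / n) * (lipNorm β b * V ^ (β / n) * ballAvg γ (fun y => ‖f y‖ₑ) x) := by gcongr
    _ = lipNorm β b * (V ^ ((α + β) / n) * ballAvg γ (fun y => ‖f y‖ₑ) x) := by
        rw [add_div, ENNReal.rpow_add _ _ (haar_pball_ne_zero γ x) (haar_pball_ne_top γ x)]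
        ring
    _ ≤ lipNorm β b * fracMax ((α + β) / n) (fun y => ‖f y‖ₑ) x := by
        gcongr
        exact rpow_mul_ballAvg_le_fracMax _ γ _ x

theorem isBoundedOp_of_ae_le_mul_fracMax (hn : n ≠ 0) (hr : IsLogHolder r) (hq : IsLogHolder q)
    (hσ : 0 ≤ σ) (hrel : ∀ x, 1 / q x = 1 / r x - σ) {T : (Qpn p n → ℝ) → Qpn p n → ℝ≥0∞}
    {c : ℝ≥0∞} (hc : c ≠ ∞)
    (hTm : ∀ f, AEMeasurable f (haar p n) → AEMeasurable (T f) (haar p n))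
    (hT : ∀ f, ∀ᵐ x ∂(haar p n), T f x ≤ c * fracMax σ (fun y => ‖f y‖ₑ) x) :
    IsBoundedOp r q T := by
  obtain ⟨C, hC⟩ := exists_varNorm_fracMax_le hn hr hq hσ hrel
  lift c to ℝ≥0 using hc
  refine ⟨c * C, fun f hf => ?_⟩
  have hle : varNorm q (T f) ≤ (c * C : ℝ≥0) * varNorm r f := by
    calc varNorm q (T f) ≤ c * varNorm q (fracMax σ fun y => ‖f y‖ₑ) :=
          varNorm_le_mul_of_ae_le hq.isExponent ENNReal.coe_ne_top (hT f)
      _ ≤ c * (C * varNorm r f) := by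
          gcongr
          exact hC _ hf.1.enorm
      _ = (c * C : ℝ≥0) * varNorm r f := by rw [ENNReal.coe_mul, mul_assoc]
  have hfin : varNorm r f < ∞ := ((memVarLp_iff hr.isExponent).1 hf).2
  exact ⟨(memVarLp_iff hq.isExponent).2
    ⟨hTm f hf.1, hle.trans_lt (ENNReal.mul_lt_top ENNReal.coe_lt_top hfin)⟩, hle⟩

theorem isBoundedOp_maxCommutator (hαβ : 0 ≤ α + β) (hn : n ≠ 0) (hβ : 0 ≤ β) (hb' : MemLip β b')
    (hbb' : b =ᵐ[haar p n] b') (hrq : IsAdmissible (α + β) r q) :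
    IsBoundedOp r q (maxCommutator α b) := by
  refine isBoundedOp_of_ae_le_mul_fracMax hn hrq.logHolder_left hrq.logHolder_right
    (by positivity) hrq.rel hb'.2.ne (fun f hf => ?_) fun f => ?_
  · exact (measurable_maxCommutator α hb'.1 hf.measurable_mk).aemeasurable.congr
      (maxCommutator_congr_ae α hbb' hf.ae_eq_mk).symm
  · filter_upwards [maxCommutator_congr_ae α hbb' (ae_eq_refl f)] with x hx
    exact hx.trans_le (maxCommutator_le_lipNorm_mul_fracMax hn α hβ hb'.2.ne f x)

end Commutator

section MeanOscillation

variable {p : ℕ} [Fact p.Prime] {n : ℕ} {α β : ℝ} {b b' : Qpn p n → ℝ} {r q : Qpn p n → ℝ}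
  {γ : ℤ} {x y : Qpn p n}

/-- The mean of the real function `b` over the ball of radius `p ^ γ` centred at `x`, the Bochner
counterpart of `ballAvg`. -/
noncomputable def ballMean (γ : ℤ) (b : Qpn p n → ℝ) (x : Qpn p n) : ℝ :=
  ⨍ z in pball γ x, b z ∂(haar p n)

lemma ballMean_eq_of_mem (b : Qpn p n → ℝ) (hy : y ∈ pball γ x) :
    ballMean γ b y = ballMean γ b x := by
  rw [ballMean, pball_eq_of_mem hy, ballMean]

lemma ballMean_congr_ae (h : b =ᵐ[haar p n] b') : ballMean γ b x = ballMean γ b' x :=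
  average_congr (ae_restrict_of_ae h)

lemma enorm_sub_ballMean_le_ballAvg (hb : LocallyIntegrable b (haar p n)) (γ : ℤ) (x : Qpn p n)
    (c : ℝ) : ‖c - ballMean γ b x‖ₑ ≤ ballAvg γ (fun y => ‖c - b y‖ₑ) x := by
  have hfin : IsFiniteMeasure ((haar p n).restrict (pball γ x)) :=
    isFiniteMeasure_restrict.2 (haar_pball_ne_top γ x)
  have hne : NeZero ((haar p n).restrict (pball γ x)) :=
    ⟨Measure.restrict_eq_zero.not.2 (haar_pball_ne_zero γ x)⟩
  exact enorm_sub_average_le_laverage (hb.integrableOn_isCompact (isCompact_pball γ x)) c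

lemma enorm_sub_ballMean_le_lipNorm_mul (hn : n ≠ 0) (hβ : 0 ≤ β) (hb : lipNorm β b ≠ ∞)
    (hbi : LocallyIntegrable b (haar p n)) (hy : y ∈ pball γ x) :
    ‖b y - ballMean γ b x‖ₑ ≤ lipNorm β b * haar p n (pball γ x) ^ (β / n) := by
  rw [← pball_eq_of_mem hy, ← ballMean_eq_of_mem b hy]
  calc ‖b y - ballMean γ b y‖ₑ ≤ ballAvg γ (fun z => ‖b y - b z‖ₑ) y :=
        enorm_sub_ballMean_le_ballAvg hbi γ y (b y)
    _ ≤ lipNorm β b * haar p n (pball γ y) ^ (β / n) * ballAvg γ (fun _ => 1) y :=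
        ballAvg_le_mul_ballAvg (ENNReal.mul_ne_top hb (rpow_haar_pball_ne_top _ γ y)) fun z hz =>
          (enorm_sub_le_lipNorm_mul_rpow_haar_pball hn hβ b hz).trans_eq (mul_one _).symm
    _ = lipNorm β b * haar p n (pball γ y) ^ (β / n) := by rw [ballAvg_const, mul_one]

lemma rpow_mul_enorm_sub_ballMean_le_maxCommutator (α : ℝ) (hb : LocallyIntegrable b (haar p n))
    (hy : y ∈ pball γ x) :
    haar p n (pball γ x) ^ (α / n) * ‖b y - ballMean γ b x‖ₑ ≤
      maxCommutator α b ((pball γ x).indicator fun _ => (1 : ℝ)) y := by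
  have hind : ballAvg γ (fun z => ‖b y - b z‖ₑ) y ≤ 1 * ballAvg γ
      (fun z => ‖b y - b z‖ₑ * ‖(pball γ y).indicator (fun _ => (1 : ℝ)) z‖ₑ) y :=
    ballAvg_le_mul_ballAvg ENNReal.one_ne_top fun z hz => by simp [Set.indicator_of_mem hz]
  rw [one_mul] at hind
  rw [maxCommutator_eq_fracMax, ← pball_eq_of_mem hy, ← ballMean_eq_of_mem b hy]
  refine le_trans ?_ (rpow_mul_ballAvg_le_fracMax _ γ _ y)
  exact mul_le_mul_right ((enorm_sub_ballMean_le_ballAvg hb γ y (b y)).trans hind) _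

lemma meanOsc_le_iff (hq : IsExponent q) {C : ℝ≥0∞} :
    meanOsc β q b ≤ C ↔ ∀ γ x,
      varNorm q ((pball γ x).indicator fun y => b y - ballMean γ b x) ≤
        C * haar p n (pball γ x) ^ (β / n) *
          varNorm q ((pball γ x).indicator fun _ => (1 : ℝ)) := by
  simp only [meanOsc, iSup_le_iff]
  refine forall₂_congr fun γ x => ?_
  rw [← ENNReal.div_eq_inv_mul,
    ENNReal.div_le_iff (rpow_haar_pball_ne_zero _ γ x) (rpow_haar_pball_ne_top _ γ x),
    ENNReal.div_le_iff
      (varNorm_indicator_one_ne_zero hq (measurableSet_pball γ x) (haar_pball_ne_zero γ x))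
      (varNorm_indicator_one_ne_top hq (measurableSet_pball γ x) (haar_pball_ne_top γ x))]
  rfl

theorem meanOsc_lt_top_of_memLip (hn : n ≠ 0) (hβ : 0 ≤ β) (hb : LocallyIntegrable b (haar p n))
    (hb' : MemLip β b') (hbb' : b =ᵐ[haar p n] b') (hq : IsExponent q) : meanOsc β q b < ∞ := by
  refine ((meanOsc_le_iff hq).2 fun γ x => ?_).trans_lt hb'.2
  refine varNorm_le_mul_of_ae_le hq
    (ENNReal.mul_ne_top hb'.2.ne (rpow_haar_pball_ne_top _ γ x)) ?_
  filter_upwards [hbb'] with y hy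
  by_cases hyx : y ∈ pball γ x
  · simpa [hyx, hy, ballMean_congr_ae hbb'] using
      enorm_sub_ballMean_le_lipNorm_mul hn hβ hb'.2.ne (hb.congr hbb') hyx
  · simp [hyx]

-- Test the operator on characteristic functions of balls.
theorem meanOsc_lt_top_of_isBoundedOp (hαβ : 0 ≤ α + β) (hb : LocallyIntegrable b (haar p n))
    (hrq : IsAdmissible (α + β) r q) (hT : IsBoundedOp r q (maxCommutator α b)) :
    meanOsc β q b < ∞ := by
  obtain ⟨C, hC⟩ := hT
  have hq := hrq.logHolder_right.isExponent
  refine ((meanOsc_le_iff (C := C * 2) hq).2 fun γ x => ?_).trans_lt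
    (ENNReal.mul_lt_top ENNReal.coe_lt_top ENNReal.ofNat_lt_top)
  set V := haar p n (pball γ x)
  set χ : Qpn p n → ℝ := (pball γ x).indicator fun _ => 1
  have hV₀ : V ≠ 0 := haar_pball_ne_zero γ x
  have hVt : V ≠ ∞ := haar_pball_ne_top γ x
  have hVα₀ : V ^ (α / n) ≠ 0 := rpow_haar_pball_ne_zero _ γ x
  have hVαt : V ^ (α / n) ≠ ∞ := rpow_haar_pball_ne_top _ γ x
  have hpt : ∀ y, ‖(pball γ x).indicator (fun y => b y - ballMean γ b x) y‖ₑ ≤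
      (V ^ (α / n))⁻¹ * maxCommutator α b χ y := by
    intro y
    by_cases hy : y ∈ pball γ x
    · rw [Set.indicator_of_mem hy, ← ENNReal.div_eq_inv_mul,
        ENNReal.le_div_iff_mul_le (Or.inl hVα₀) (Or.inl hVαt), mul_comm]
      exact rpow_mul_enorm_sub_ballMean_le_maxCommutator α hb hy
    · simp [hy]
  calc varNorm q ((pball γ x).indicator fun y => b y - ballMean γ b x)
      ≤ (V ^ (α / n))⁻¹ * varNorm q (maxCommutator α b χ) :=
        varNorm_le_mul_of_ae_le hq (ENNReal.inv_ne_top.2 hVα₀) (ae_of_all _ hpt)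
    _ ≤ (V ^ (α / n))⁻¹ * (C * (2 * V ^ ((α + β) / n) * varNorm q χ)) := by
        gcongr
        refine (hC χ (memVarLp_indicator_one hrq.isExponent (measurableSet_pball γ x) hVt)).2.trans
          (mul_le_mul_right ?_ _)
        exact varNorm_indicator_one_le hrq.isExponent hq (by positivity) hrq.rel
          (measurableSet_pball γ x) hV₀ hVt
    _ = (V ^ (α / n))⁻¹ * V ^ (α / n) * (C * 2 * V ^ (β / n) * varNorm q χ) := by
        rw [add_div, ENNReal.rpow_add _ _ hV₀ hVt]
        ring
    _ = C * 2 * V ^ (β / n) * varNorm q χ := by rw [ENNReal.inv_mul_cancel hVα₀ hVαt, one_mul]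

end MeanOscillation

section Campanato

variable {p : ℕ} [Fact p.Prime] {n : ℕ} {β : ℝ} {b : Qpn p n → ℝ} {D : ℝ≥0∞} {γ : ℤ}
  {x : Qpn p n}

lemma exists_ballAvg_mul_varNorm_indicator_one_le (hn : n ≠ 0) {q : Qpn p n → ℝ}
    (hq : IsLogHolder q) :
    ∃ C : ℝ≥0, ∀ (γ : ℤ) (x : Qpn p n) (F : Qpn p n → ℝ≥0∞), AEMeasurable F (haar p n) →
      ballAvg γ F x * varNorm q ((pball γ x).indicator fun _ => (1 : ℝ)) ≤ C * varNorm q F := by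
  obtain ⟨C, hC⟩ := exists_varNorm_fracMax_le hn hq hq le_rfl fun x => (sub_zero _).symm
  refine ⟨C, fun γ x F hF => ENNReal.mul_le_of_forall_lt fun A hA X hX => ?_⟩
  rcases eq_or_ne A 0 with rfl | hA₀
  · rw [zero_mul]
    exact zero_le
  have hpt : ∀ y, ‖(pball γ x).indicator (fun _ => (1 : ℝ)) y‖ₑ ≤ A⁻¹ * fracMax 0 F y := by
    intro y
    by_cases hy : y ∈ pball γ x
    · rw [Set.indicator_of_mem hy, enorm_one, ← ENNReal.inv_mul_cancel hA₀ hA.ne_top]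
      gcongr
      exact hA.le.trans ((ballAvg_eq_of_mem le_rfl F hy).symm.trans_le
        (ballAvg_le_fracMax_zero γ F y))
    · simp [hy]
  calc A * X ≤ A * (A⁻¹ * varNorm q (fracMax 0 F)) := by
        gcongr
        exact hX.le.trans (varNorm_le_mul_of_ae_le hq.isExponent (ENNReal.inv_ne_top.2 hA₀)
          (ae_of_all _ hpt))
    _ = varNorm q (fracMax 0 F) := by
        rw [← mul_assoc, ENNReal.mul_inv_cancel hA₀ hA.ne_top, one_mul]
    _ ≤ C * varNorm q F := hC F hF

/-- The Campanato condition of order `β` with constant `D`: the mean oscillation of `b` over any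
ball of radius `p ^ γ` is at most `D p ^ (γ β)`. -/
def IsCampanato (β : ℝ) (D : ℝ≥0∞) (b : Qpn p n → ℝ) : Prop :=
  ∀ (γ : ℤ) (x : Qpn p n),
    ballAvg γ (fun y => ‖b y - ballMean γ b x‖ₑ) x ≤ D * (p : ℝ≥0∞) ^ (γ * β)

lemma exists_isCampanato_of_meanOsc_lt_top (hn : n ≠ 0) (hb : AEMeasurable b (haar p n))
    {q : Qpn p n → ℝ} (hq : IsLogHolder q) (hosc : meanOsc β q b < ∞) :
    ∃ D : ℝ≥0, IsCampanato β D b := by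
  obtain ⟨C, hC⟩ := exists_ballAvg_mul_varNorm_indicator_one_le hn hq
  lift meanOsc β q b to ℝ≥0 using hosc.ne with M hM
  refine ⟨C * M, fun γ x => ?_⟩
  have hosc' := (meanOsc_le_iff hq.isExponent).1 hM.ge γ x
  rw [haar_pball_rpow_div hn] at hosc'
  set φ : Qpn p n → ℝ := (pball γ x).indicator fun y => b y - ballMean γ b x with hφ
  set X := varNorm q ((pball γ x).indicator fun _ => (1 : ℝ))
  have hφm : AEMeasurable φ (haar p n) := (hb.sub_const _).indicator (measurableSet_pball γ x)
  have hle : ballAvg γ (fun y => ‖b y - ballMean γ b x‖ₑ) x ≤ 1 * ballAvg γ (fun y => ‖φ y‖ₑ) x :=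
    ballAvg_le_mul_ballAvg ENNReal.one_ne_top fun y hy => by simp [hφ, hy]
  refine (ENNReal.mul_le_mul_iff_left
    (varNorm_indicator_one_ne_zero hq.isExponent (measurableSet_pball γ x) (haar_pball_ne_zero γ x))
    (varNorm_indicator_one_ne_top hq.isExponent (measurableSet_pball γ x)
      (haar_pball_ne_top γ x))).1 ?_
  calc _ ≤ ballAvg γ (fun y => ‖φ y‖ₑ) x * X := mul_le_mul_left (hle.trans_eq (one_mul _)) _
    _ ≤ C * (M * (p : ℝ≥0∞) ^ (γ * β) * X) :=
        (hC γ x _ hφm.enorm).trans (mul_le_mul_right hosc' _)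
    _ = (C * M : ℝ≥0) * (p : ℝ≥0∞) ^ (γ * β) * X := by
        rw [ENNReal.coe_mul]
        ring

lemma ballAvg_sub_one_le (γ : ℤ) (F : Qpn p n → ℝ≥0∞) (x : Qpn p n) :
    ballAvg (γ - 1) F x ≤ (p : ℝ≥0∞) ^ n * ballAvg γ F x := by
  have hp : (p : ℝ≥0∞) ^ n ≠ 0 := pow_ne_zero n prime_ennreal_ne_zero
  have hpt : (p : ℝ≥0∞) ^ n ≠ ∞ := ENNReal.pow_ne_top (ENNReal.natCast_ne_top p)
  rw [ballAvg_eq_inv_mul, ballAvg_eq_inv_mul, haar_pball_eq_mul_haar_pball_sub_one γ,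
    ENNReal.mul_inv (Or.inl hp) (Or.inl hpt), ← mul_assoc, ← mul_assoc,
    ENNReal.mul_inv_cancel hp hpt, one_mul]
  gcongr
  exact pball_mono (by omega) x

lemma tendsto_atBot_iff_tendsto_sub_natCast {X : Type*} {f : ℤ → X} {l : Filter X} (γ : ℤ) :
    Tendsto f atBot l ↔ Tendsto (fun k : ℕ => f (γ - k)) atTop l := by
  have h : map (fun k : ℕ => γ - (k : ℤ)) atTop = atBot := by
    rw [← Function.comp_def, ← map_map, Nat.map_cast_int_atTop]
    exact (OrderIso.subLeft γ).map_atTop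
  rw [← h, tendsto_map'_iff, Function.comp_def]

lemma IsCampanato.edist_ballMean_sub_one_le (hD : IsCampanato β D b)
    (hb : LocallyIntegrable b (haar p n)) (γ : ℤ) (x : Qpn p n) :
    edist (ballMean γ b x) (ballMean (γ - 1) b x) ≤
      (p : ℝ≥0∞) ^ n * D * (p : ℝ≥0∞) ^ (γ * β) :=
  calc edist (ballMean γ b x) (ballMean (γ - 1) b x)
      ≤ ballAvg (γ - 1) (fun y => ‖ballMean γ b x - b y‖ₑ) x := by
        rw [edist_eq_enorm_sub]
        exact enorm_sub_ballMean_le_ballAvg hb _ x _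
    _ ≤ (p : ℝ≥0∞) ^ n * ballAvg γ (fun y => ‖b y - ballMean γ b x‖ₑ) x := by
        simp only [enorm_sub_rev (ballMean γ b x)]
        exact ballAvg_sub_one_le γ _ x
    _ ≤ (p : ℝ≥0∞) ^ n * D * (p : ℝ≥0∞) ^ (γ * β) := by
        rw [mul_assoc]
        gcongr
        exact hD γ x

lemma IsCampanato.edist_ballMean_sub_natCast_le (hD : IsCampanato β D b)
    (hb : LocallyIntegrable b (haar p n)) (γ : ℤ) (x : Qpn p n) (k : ℕ) :
    edist (ballMean (γ - k) b x) (ballMean (γ - (k + 1 : ℕ)) b x) ≤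
      (p : ℝ≥0∞) ^ n * D * (p : ℝ≥0∞) ^ (γ * β) * ((p : ℝ≥0∞) ^ (-β)) ^ k := by
  have hk : γ - (k + 1 : ℕ) = γ - k - 1 := by
    push_cast
    ring
  rw [hk]
  refine (hD.edist_ballMean_sub_one_le hb (γ - k) x).trans_eq ?_
  rw [mul_assoc _ ((p : ℝ≥0∞) ^ (γ * β)), ← ENNReal.rpow_mul_natCast,
    ← ENNReal.rpow_add _ _ prime_ennreal_ne_zero (ENNReal.natCast_ne_top p)]
  congr 2
  push_cast
  ring

lemma rpow_neg_prime_lt_one (hβ : 0 < β) : (p : ℝ≥0∞) ^ (-β) < 1 :=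
  ENNReal.rpow_lt_one_of_one_lt_of_neg
    (by exact_mod_cast (Fact.out : p.Prime).one_lt) (neg_lt_zero.2 hβ)

lemma IsCampanato.exists_tendsto_ballMean (hD : IsCampanato β D b) (hβ : 0 < β)
    (hb : LocallyIntegrable b (haar p n)) (hDt : D ≠ ∞) (x : Qpn p n) :
    ∃ l, Tendsto (fun γ => ballMean γ b x) atBot (𝓝 l) := by
  simp only [tendsto_atBot_iff_tendsto_sub_natCast 0]
  have hpn : (p : ℝ≥0∞) ^ n ≠ ∞ := ENNReal.pow_ne_top (ENNReal.natCast_ne_top p)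
  refine cauchySeq_tendsto_of_complete (cauchySeq_of_edist_le_geometric _ _
    (rpow_neg_prime_lt_one hβ) ?_ (hD.edist_ballMean_sub_natCast_le hb 0 x))
  simp [ENNReal.mul_ne_top hpn hDt]

lemma IsCampanato.edist_le_of_tendsto_ballMean (hD : IsCampanato β D b)
    (hb : LocallyIntegrable b (haar p n)) {l : ℝ}
    (hl : Tendsto (fun γ => ballMean γ b x) atBot (𝓝 l)) (γ : ℤ) :
    edist (ballMean γ b x) l ≤
      (p : ℝ≥0∞) ^ n * D / (1 - (p : ℝ≥0∞) ^ (-β)) * (p : ℝ≥0∞) ^ (γ * β) := by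
  have h := edist_le_of_edist_le_geometric_of_tendsto₀ _ _
    (hD.edist_ballMean_sub_natCast_le hb γ x) ((tendsto_atBot_iff_tendsto_sub_natCast γ).1 hl)
  rw [Nat.cast_zero, sub_zero] at h
  exact h.trans_eq ENNReal.mul_div_right_comm

lemma lipNorm_le {f : Qpn p n → ℝ} {C : ℝ≥0∞}
    (h : ∀ x y, ‖f x - f y‖ₑ ≤ C * ‖x - y‖ₑ ^ β) : lipNorm β f ≤ C :=
  iSup₂_le fun x y => iSup_le fun _ => ENNReal.div_le_of_le_mul (h x y)

-- The balls of radius `‖x - y‖` around `x` and `y` coincide, so `b' x` and `b' y` are compared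
-- through the mean over this common ball.
lemma IsCampanato.memLip_of_tendsto_ballMean (hD : IsCampanato β D b) (hβ : 0 < β)
    (hb : LocallyIntegrable b (haar p n)) (hDt : D ≠ ∞) {b' : Qpn p n → ℝ}
    (hb' : ∀ x, Tendsto (fun γ => ballMean γ b x) atBot (𝓝 (b' x))) : MemLip β b' := by
  set K := (p : ℝ≥0∞) ^ n * D / (1 - (p : ℝ≥0∞) ^ (-β))
  have hKt : K ≠ ∞ := ENNReal.div_ne_top
    (ENNReal.mul_ne_top (ENNReal.pow_ne_top (ENNReal.natCast_ne_top p)) hDt)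
    (tsub_pos_of_lt (rpow_neg_prime_lt_one hβ)).ne'
  refine ⟨measurable_of_tendsto_metrizable' (f := fun γ x => ballMean γ b x) atBot
    (fun γ => measurable_of_const_on_pball fun x y hy => ballMean_eq_of_mem b hy)
    (tendsto_pi_nhds.2 hb'), (lipNorm_le (C := 2 * K) fun x y => ?_).trans_lt
      (ENNReal.mul_lt_top ENNReal.ofNat_lt_top hKt.lt_top)⟩
  rcases eq_or_ne x y with rfl | hxy
  · simp
  obtain ⟨γ, hγ⟩ := exists_norm_eq_zpow (sub_ne_zero.2 hxy)
  have hmean : ballMean γ b x = ballMean γ b y := ballMean_eq_of_mem b (mem_pball.2 hγ.le)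
  have hnorm : ‖x - y‖ₑ ^ β = (p : ℝ≥0∞) ^ (γ * β) := by
    rw [← ofReal_norm, hγ, ofReal_prime_zpow, ENNReal.rpow_mul]
  calc ‖b' x - b' y‖ₑ ≤ edist (ballMean γ b x) (b' x) + edist (ballMean γ b x) (b' y) := by
        rw [← edist_eq_enorm_sub]
        exact edist_triangle_left _ _ _
    _ ≤ K * (p : ℝ≥0∞) ^ (γ * β) + K * (p : ℝ≥0∞) ^ (γ * β) := by
        gcongr
        · exact hD.edist_le_of_tendsto_ballMean hb (hb' x) γ
        · exact hmean ▸ hD.edist_le_of_tendsto_ballMean hb (hb' y) γ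
    _ = 2 * K * ‖x - y‖ₑ ^ β := by
        rw [hnorm]
        ring

lemma ae_tendsto_ballMean (hb : LocallyIntegrable b (haar p n)) :
    ∀ᵐ x ∂(haar p n), Tendsto (fun γ => ballMean γ b x) atBot (𝓝 (b x)) := by
  have hradius : Tendsto (fun γ : ℤ => (p : ℝ) ^ γ) atBot (𝓝[>] 0) := by
    refine tendsto_nhdsWithin_iff.2 ⟨(tendsto_atBot_iff_tendsto_sub_natCast 0).2 ?_,
      Eventually.of_forall zpow_prime_pos⟩
    simpa [Pi.inv_def] using
      (tendsto_pow_atTop_atTop_of_one_lt (one_lt_prime (p := p))).inv_tendsto_atTop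
  filter_upwards [IsUnifLocDoublingMeasure.ae_tendsto_average (haar p n) hb 1] with x hx
  exact hx (fun _ => x) _ hradius
    (Eventually.of_forall fun γ => Metric.mem_closedBall_self
      (by simpa only [one_mul] using (zpow_prime_pos γ).le))

theorem IsCampanato.exists_memLip_ae_eq (hD : IsCampanato β D b) (hβ : 0 < β)
    (hb : LocallyIntegrable b (haar p n)) (hDt : D ≠ ∞) :
    ∃ b' : Qpn p n → ℝ, MemLip β b' ∧ b =ᵐ[haar p n] b' := by
  choose b' hb' using hD.exists_tendsto_ballMean hβ hb hDt
  refine ⟨b', hD.memLip_of_tendsto_ballMean hβ hb hDt hb', ?_⟩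
  filter_upwards [ae_tendsto_ballMean hb] with x hx
  exact tendsto_nhds_unique hx (hb' x)

end Campanato

section ConstantExponent

variable {p : ℕ} [Fact p.Prime] {n : ℕ}

lemma isLogHolder_const {c : ℝ} (hc : 1 < c) : IsLogHolder (fun _ : Qpn p n => c) := by
  refine ⟨⟨measurable_const, ?_, fun x => ?_, fun x => ?_⟩, ⟨1, one_pos, fun γ x => ?_⟩,
    ⟨1, one_pos, fun x y => ?_⟩⟩
  · rwa [essInf_const _ (NeZero.ne _)]
  · rw [essInf_const _ (NeZero.ne _)]
  · rw [essSup_const _ (NeZero.ne _)]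
  · have hball : (haar p n).restrict (pball γ x) ≠ 0 :=
      Measure.restrict_eq_zero.not.2 (haar_pball_ne_zero γ x)
    rw [essInf_const _ hball, essSup_const _ hball, sub_self, mul_zero]
    exact zero_le_one
  · rw [sub_self, abs_zero]
    exact div_nonneg zero_le_one (Real.logb_nonneg one_lt_prime
      (le_add_of_le_of_nonneg one_lt_prime.le (le_min (norm_nonneg x) (norm_nonneg y))))

lemma exists_isAdmissible {s : ℝ} (hs : 0 < s) (hsn : s < n) :
    ∃ r q : Qpn p n → ℝ, IsAdmissible s r q := by
  obtain ⟨c, hc₁, hc⟩ := exists_between ((one_lt_div hs).2 hsn)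
  have hpos : 0 < 1 / c - s / n := by
    rw [sub_pos, ← one_div_div (n : ℝ)]
    exact one_div_lt_one_div_of_lt (zero_lt_one.trans hc₁) hc
  have hlt : 1 / c - s / n < 1 :=
    (sub_le_self _ (div_nonneg hs.le (hs.trans hsn).le)).trans_lt
      ((div_lt_one (zero_lt_one.trans hc₁)).2 hc₁)
  refine ⟨fun _ => c, fun _ => 1 / (1 / c - s / n), isLogHolder_const hc₁,
    isLogHolder_const ((one_lt_div hpos).2 hlt), (isLogHolder_const hc₁).isExponent, ?_,
    fun _ => one_div_one_div _⟩
  rwa [essSup_const _ (NeZero.ne _)]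

end ConstantExponent

end PadicVarLebesgue

open PadicVarLebesgue in
theorem theorem2_general (p : ℕ) [Fact p.Prime] (n : ℕ) (α β : ℝ)
    (hβ : 0 < β) (hs : 0 < α + β) (hαβ : α + β < n)
    (b : Qpn p n → ℝ) (hb : LocallyIntegrable b (haar p n)) :
    List.TFAE [
      ∃ b' : Qpn p n → ℝ, MemLip β b' ∧ b =ᵐ[haar p n] b',
      ∀ r q : Qpn p n → ℝ, IsAdmissible (α + β) r q → IsBoundedOp r q (maxCommutator α b),
      ∃ r q : Qpn p n → ℝ, IsAdmissible (α + β) r q ∧ IsBoundedOp r q (maxCommutator α b),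
      ∃ r q : Qpn p n → ℝ, IsAdmissible (α + β) r q ∧ meanOsc β q b < ∞,
      ∀ r q : Qpn p n → ℝ, IsAdmissible (α + β) r q → meanOsc β q b < ∞] := by
  have hn : n ≠ 0 := Nat.cast_ne_zero.1 (hs.trans hαβ).ne'
  obtain ⟨r₀, q₀, hrq₀⟩ := exists_isAdmissible (p := p) hs hαβ
  tfae_have 1 → 2 := fun ⟨b', hb', hbb'⟩ r q hrq =>
    isBoundedOp_maxCommutator hs.le hn hβ.le hb' hbb' hrq
  tfae_have 2 → 3 := fun h => ⟨r₀, q₀, hrq₀, h r₀ q₀ hrq₀⟩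
  tfae_have 3 → 4 := fun ⟨r, q, hrq, hT⟩ =>
    ⟨r, q, hrq, meanOsc_lt_top_of_isBoundedOp hs.le hb hrq hT⟩
  tfae_have 4 → 1 := by
    rintro ⟨r, q, hrq, hosc⟩
    obtain ⟨D, hD⟩ := exists_isCampanato_of_meanOsc_lt_top hn
      hb.aestronglyMeasurable.aemeasurable hrq.logHolder_right hosc
    exact hD.exists_memLip_ae_eq hβ hb ENNReal.coe_ne_top
  tfae_have 1 → 5 := fun ⟨b', hb', hbb'⟩ r q hrq =>
    meanOsc_lt_top_of_memLip hn hβ.le hb hb' hbb' hrq.logHolder_right.isExponent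
  tfae_have 5 → 4 := fun h => ⟨r₀, q₀, hrq₀, h r₀ q₀ hrq₀⟩
  tfae_finish

open PadicVarLebesgue in
theorem theorem2 (p : ℕ) [Fact p.Prime] (n : ℕ) (α β : ℝ)
    (hβ₀ : 0 < β) (hβ₁ : β < 1) (hα : 0 < α) (hαβ : α + β < n)
    (b : Qpn p n → ℝ) (hb : LocallyIntegrable b (haar p n)) :
    List.TFAE [
      ∃ b' : Qpn p n → ℝ, MemLip β b' ∧ b =ᵐ[haar p n] b',
      ∀ r q : Qpn p n → ℝ, IsAdmissible (α + β) r q → IsBoundedOp r q (maxCommutator α b),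
      ∃ r q : Qpn p n → ℝ, IsAdmissible (α + β) r q ∧ IsBoundedOp r q (maxCommutator α b),
      ∃ r q : Qpn p n → ℝ, IsAdmissible (α + β) r q ∧ meanOsc β q b < ∞,
      ∀ r q : Qpn p n → ℝ, IsAdmissible (α + β) r q → meanOsc β q b < ∞] :=
  theorem2_general p n α β hβ₀ (add_pos hα hβ₀) hαβ b hb
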